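/- Let $\Gamma$ be a profinite group and let $\ell$ be a prime number. Let $\Gamma\text{-mod}_\ell$ be the abelian category of finite abelian $\ell$-groups equipped with a discrete action of $\Gamma$ (i.e. an action by group automorphisms such that the stabilizer of every element is open), with $\Gamma$-equivariant homomorphisms as morphisms. Let $\mathrm{hd}(\Gamma\text{-mod}_\ell)$ be its homological dimension, i.e. the smallest integer $n \ge 0$ such that $\mathrm{Ext}^i(X,Y) = 0$ for all objects $X, Y$ of $\Gamma\text{-mod}_\ell$ and all $i > n$, and $\infty$ if there is no such $n$. Let $\mathrm{cd}_\ell(\Gamma)$ be the $\ell$-th cohomological dimension of $\Gamma$, i.e. the smallest integer $n$ such that $H^i(\Gamma, M) = 0$ for all $i > n$ and all $\ell$-primary torsion discrete $\Gamma$-modules $M$, and $\infty$ if there is no such $n$. Then \[ \mathrm{hd}(\Gamma\text{-mod}_\ell) = \mathrm{cd}_\ell(\Gamma) + 1, \] with the convention $\infty + 1 = \infty$. -/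

import Mathlib

open CategoryTheory Limits Abelian

universe u v

section HomologicalDimension

/-- The homological dimension of an abelian category: the smallest `n` (possibly `⊤`) such that
`Ext^i(X, Y) = 0` for all objects `X`, `Y` and all `i > n`. -/
noncomputable def homologicalDimension (C : Type u) [Category.{v} C] [Abelian C] : ℕ∞ :=
  letI := HasExt.standard C
  sInf {n : ℕ∞ | ∀ i : ℕ, n < (i : ℕ∞) → ∀ X Y : C, Subsingleton (Ext.{max u v} X Y i)}

end HomologicalDimension

section DiscreteModules

/-- The property of a `k`-linear `Γ`-module (a `Γ`-module for `k = ℤ`) of being a finite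
`ℓ`-group with discrete action of `Γ`, i.e. with open stabilizers. -/
structure IsFiniteDiscretePrimary (k : Type v) [CommRing k] (Γ : Type u) [Group Γ]
    [TopologicalSpace Γ] (ℓ : ℕ) (M : Rep.{u} k Γ) : Prop where
  finite : Finite M.V
  primary : ∀ m : M.V, ∃ n : ℕ, ℓ ^ n • m = 0
  discrete : ∀ m : M.V, IsOpen {g : Γ | M.ρ g m = m}

/-- `IsFiniteDiscretePrimary` as a property of objects of the category of `k`-linear `Γ`-modules. -/
def finiteDiscretePrimary (k : Type v) [CommRing k] (Γ : Type u) [Group Γ] [TopologicalSpace Γ]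
    (ℓ : ℕ) : ObjectProperty (Rep.{u} k Γ) :=
  fun M => IsFiniteDiscretePrimary k Γ ℓ M

/-- The category of finite abelian `ℓ`-groups with discrete action of `Γ`, and `Γ`-equivariant
homomorphisms. -/
abbrev FinDiscMod (Γ : Type u) [Group Γ] [TopologicalSpace Γ] (ℓ : ℕ) : Type (u + 1) :=
  (finiteDiscretePrimary ℤ Γ ℓ).FullSubcategory

variable {k : Type v} [CommRing k] {Γ : Type u} [Group Γ] [TopologicalSpace Γ] {ℓ : ℕ}

lemma isFiniteDiscretePrimary_of_jointly_injective {J : Type*} [Finite J] {A : Rep.{u} k Γ}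
    {B : J → Rep.{u} k Γ} (f : ∀ j, A ⟶ B j)
    (hf : ∀ x y : A.V, (∀ j, (f j).hom x = (f j).hom y) → x = y)
    (hB : ∀ j, IsFiniteDiscretePrimary k Γ ℓ (B j)) : IsFiniteDiscretePrimary k Γ ℓ A where
  finite := by
    have := fun j => (hB j).finite
    exact Finite.of_injective (fun (x : A.V) (j : J) => (f j).hom x)
      fun x y h => hf x y fun j => congrFun h j
  primary m := by
    classical
    have := Fintype.ofFinite J
    choose n hn using fun j => (hB j).primary ((f j).hom m)
    refine ⟨∑ j, n j, hf _ _ fun j => ?_⟩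
    rw [map_nsmul, map_zero, ← Finset.sum_erase_add _ _ (Finset.mem_univ j), pow_add, mul_smul,
      hn j, smul_zero]
  discrete m := by
    have : {g : Γ | A.ρ g m = m} =
        ⋂ j, {g : Γ | (B j).ρ g ((f j).hom m) = (f j).hom m} := by
      ext g
      simp only [Set.mem_ofPred_eq, Set.mem_iInter, ← Rep.hom_comm_apply]
      exact ⟨fun h j => by rw [h], fun h => hf _ _ h⟩
    rw [this]
    exact isOpen_iInter_of_finite fun j => (hB j).discrete _

lemma isFiniteDiscretePrimary_of_surjective [IsTopologicalGroup Γ] {A B : Rep.{u} k Γ}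
    (f : A ⟶ B) (hf : Function.Surjective f.hom) (hA : IsFiniteDiscretePrimary k Γ ℓ A) :
    IsFiniteDiscretePrimary k Γ ℓ B where
  finite := by
    have := hA.finite
    exact Finite.of_surjective _ hf
  primary m := by
    obtain ⟨a, rfl⟩ := hf m
    obtain ⟨n, hn⟩ := hA.primary a
    exact ⟨n, by rw [← map_nsmul, hn, map_zero]⟩
  discrete m := by
    obtain ⟨a, rfl⟩ := hf m
    let S : Subgroup Γ :=
      { carrier := {g | B.ρ g (f.hom a) = f.hom a}
        one_mem' := by simp
        mul_mem' := fun {g h} hg hh => by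
          simp only [Set.mem_ofPred_eq] at hg hh ⊢
          have : B.ρ (g * h) (f.hom a) = B.ρ g (B.ρ h (f.hom a)) := by rw [map_mul]; rfl
          rw [this, hh, hg]
        inv_mem' := fun {g} hg => by
          simp only [Set.mem_ofPred_eq] at hg ⊢
          conv_lhs => rw [← hg]
          simp }
    change IsOpen (S : Set Γ)
    refine S.isOpen_of_mem_nhds (g := 1) (Filter.mem_of_superset
      ((hA.discrete a).mem_nhds (by simp)) fun g hg => ?_)
    change B.ρ g (f.hom a) = f.hom a
    rw [← Rep.hom_comm_apply, show A.ρ g a = a from hg]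

instance : (finiteDiscretePrimary k Γ ℓ).IsClosedUnderSubobjects where
  prop_of_mono f _ hY :=
    isFiniteDiscretePrimary_of_jointly_injective (J := Unit) (fun _ => f)
      (fun _ _ h => (Rep.mono_iff_injective f).1 inferInstance (h ())) fun _ => hY

instance [IsTopologicalGroup Γ] : (finiteDiscretePrimary k Γ ℓ).IsClosedUnderQuotients where
  prop_of_epi f _ hX :=
    isFiniteDiscretePrimary_of_surjective f ((Rep.epi_iff_surjective f).1 inferInstance) hX

instance : (finiteDiscretePrimary k Γ ℓ).IsClosedUnderFiniteProducts where
  isClosedUnderLimitsOfShape J _ := ⟨by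
    rintro X ⟨p⟩
    exact isFiniteDiscretePrimary_of_jointly_injective (fun j => p.π.app ⟨j⟩)
      (fun x y h => Concrete.isLimit_ext _
        (isLimitOfPreserves (forget₂ (Rep.{u} k Γ) (ModuleCat.{u} k)) p.isLimit) x y
        fun j => h j.as)
      fun j => p.prop_diag_obj ⟨j⟩⟩

instance : (finiteDiscretePrimary k Γ ℓ).ContainsZero where
  exists_zero := ⟨Rep.of (Representation.trivial k Γ PUnit.{u + 1}), by
    rw [IsZero.iff_id_eq_zero]; ext, by
    exact isFiniteDiscretePrimary_of_jointly_injective (J := Empty) (B := fun j => j.elim)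
      (fun j => j.elim) (fun _ _ _ => rfl) fun j => j.elim⟩

end DiscreteModules

section CohomologicalDimension

/-- The `ℓ`-th cohomological dimension of `Γ`: the smallest `n` (possibly `⊤`) such that
`H^i(Γ, M) = 0` for all `i > n` and all `ℓ`-primary torsion discrete `Γ`-modules `M`. -/
noncomputable def cohomologicalDimension (Γ : Type u) [Group Γ] [TopologicalSpace Γ]
    [IsTopologicalGroup Γ] (ℓ : ℕ) : ℕ∞ :=
  sInf {n : ℕ∞ | ∀ i : ℕ, n < (i : ℕ∞) → ∀ M : TopRep.{u} ℤ Γ,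
    DiscreteTopology M.V → (∀ m : M.V, IsOpen {g : Γ | M.ρ g m = m}) →
    (∀ m : M.V, ∃ k : ℕ, ℓ ^ k • m = 0) → Subsingleton (continuousCohomology i M)}

end CohomologicalDimension

/-! Write `ℤ` for the trivial module. All computations take place in the category `DiscMod Γ` of all
discrete modules. There an `ℓ`-primary module embeds into `C(Γ, E)` with `E` divisible and
`ℓ`-primary; by Frobenius reciprocity this coinduced module is injective, and it is again divisible
and `ℓ`-primary (`DiscMod.exists_mono_injective`).

Two translations are needed. `Ext` between finite `ℓ`-primary modules is the same in both categories
(`FinDiscMod.subsingleton_ext_iff`), because a class of positive degree dies on some finite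
`ℓ`-primary module surjecting onto its source. For `T` `ℓ`-primary and `i > 0`, `H^i(Γ, T)` vanishes
exactly when `Ext^i(ℤ, T)` does (`DiscMod.subsingleton_continuousCohomology_iff_ext`), because the
standard resolution consists of coinduced, hence acyclic, modules.

Upper bound: embed `Y` into an injective divisible `J` with quotient `Q`. Then `Ext^{n+2}(X, Y)` is
a quotient of `Ext^{n+1}(X, Q)`, and since `Q` is divisible the latter vanishes as soon as
`H^{n+1}(Γ, Hom(X, Q))` does (`DiscMod.subsingleton_ext_of_ihom`). The extra degree is the price of
making the target divisible.

Lower bound: if `Ext^{n+2}(ℤ/ℓ, W) = 0` with `W` finite, multiplication by `ℓ` is surjective on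
`Ext^{n+1}(ℤ, W)`, which a power of `ℓ` kills, so this group is zero
(`DiscMod.subsingleton_ext_unit_of_zmod`). A cochain takes finitely many values, so vanishing for
finite `W` gives it for all `ℓ`-primary modules. The same argument one degree lower, with `Hom(ℤ,
ℤ/ℓ) ≠ 0`, shows `Ext^1(ℤ/ℓ, ℤ/ℓ) ≠ 0`, so the homological dimension is positive. -/

set_option linter.unusedSectionVars false

/-! ### Effaceability of extension classes, and comparison of `Ext` along exact functors -/

section Effaceability

universe w w' u₁ v₁ u₂ v₂

variable {C : Type u₁} [Category.{v₁} C] [Abelian C]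

-- Everything in `K^0` is a cycle, so `K^0 → H^0(K) ≅ X` is an epimorphism, and `K^0` placed in
-- degree 0 maps to `K` by the identity.
open HomologicalComplex in
lemma CochainComplex.exists_epi_single_map_eq {X : C} {K : CochainComplex C ℤ} [K.IsStrictlyLE 0]
    (s : K ⟶ (single C (ComplexShape.up ℤ) 0).obj X) [QuasiIsoAt s 0] :
    ∃ (X' : C) (p : X' ⟶ X) (t : (single C (ComplexShape.up ℤ) 0).obj X' ⟶ K),
      Epi p ∧ t ≫ s = (single C (ComplexShape.up ℤ) 0).map p := by
  have hd : K.d 0 1 = 0 := (K.isZero_of_isStrictlyLE 0 1 (by simp)).eq_of_tgt _ _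
  have hK : ∀ j, (ComplexShape.up ℤ).Rel 0 j → 𝟙 (K.X 0) ≫ K.d 0 j = 0 := by
    intro j hj
    obtain rfl : 0 + 1 = j := hj
    exact (K.isZero_of_isStrictlyLE 0 (0 + 1) (by simp)).eq_of_tgt _ _
  refine ⟨K.X 0, s.f 0 ≫ (singleObjXSelf (ComplexShape.up ℤ) 0 X).hom,
    mkHomFromSingle (𝟙 _) hK, ?_, ?_⟩
  · let i := K.iCyclesIso 0 1 (by simp) hd
    have : s.f 0 ≫ (singleObjXSelf (ComplexShape.up ℤ) 0 X).hom =
        i.inv ≫ K.homologyπ 0 ≫ homologyMap s 0 ≫ (singleObjHomologySelfIso _ _ _).hom := by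
      rw [Iso.eq_inv_comp, homologyπ_naturality_assoc, homologyπ_singleObjHomologySelfIso_hom,
        ← cancel_mono (singleObjXSelf (ComplexShape.up ℤ) 0 X).inv]
      have h := singleObjCyclesSelfIso_inv_iCycles (ComplexShape.up ℤ) 0 X
      rw [Iso.inv_comp_eq] at h
      simp [i, ← h]
    rw [this]
    infer_instance
  · apply HomologicalComplex.from_single_hom_ext
    simp [single_map_f_self]

/-- Represent `φ` by a left fraction through some `K` in degrees `≤ 0`. After restriction to `K^0`
it becomes an honest chain map from degree 0 into `L`, and `L` is zero there. -/
lemma DerivedCategory.exists_epi_map_comp_eq_zero [HasDerivedCategory.{w} C] {X : C}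
    {L : CochainComplex C ℤ} (φ : Q.obj ((CochainComplex.singleFunctor C 0).obj X) ⟶ Q.obj L)
    (n : ℤ) (hn : n < 0) [L.IsStrictlyLE n] :
    ∃ (X' : C) (p : X' ⟶ X), Epi p ∧
      Q.map ((CochainComplex.singleFunctor C 0).map p) ≫ φ = 0 := by
  obtain ⟨K, _, s, h, g, rfl⟩ := right_fac_of_isStrictlyLE φ 0
  have hs : QuasiIso s := by rwa [isIso_Q_map_iff_quasiIso] at h
  obtain ⟨X', p, t, hp, hts⟩ :=
    @CochainComplex.exists_epi_single_map_eq _ _ _ X K _ s (hs.quasiIsoAt 0)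
  have htg : t ≫ g = 0 := by
    apply HomologicalComplex.from_single_hom_ext
    apply (L.isZero_of_isStrictlyLE n 0 hn).eq_of_tgt
  refine ⟨X', p, hp, ?_⟩
  have h1 : Q.map ((CochainComplex.singleFunctor C 0).map p) = Q.map t ≫ Q.map s := by
    rw [← Q.map_comp]; exact congrArg Q.map hts.symm
  rw [h1]
  erw [Category.assoc, IsIso.hom_inv_id_assoc, ← Q.map_comp, htg, Q.map_zero]
  rfl

namespace CategoryTheory.Abelian.Ext

open _root_.DerivedCategory in
/-- Every extension class of positive degree is killed by an epimorphism onto its source. -/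
lemma exists_epi_mk₀_comp_eq_zero [HasExt.{w} C] {X Y : C} {n : ℕ} (e : Ext X Y (n + 1)) :
    ∃ (X' : C) (p : X' ⟶ X), Epi p ∧ (mk₀ p).comp e (zero_add _) = 0 := by
  let := HasDerivedCategory.standard C
  obtain ⟨X', p, hp, h⟩ := exists_epi_map_comp_eq_zero (X := X)
    (L := (CochainComplex.singleFunctor C (-(n + 1 : ℤ))).obj Y)
    (e.hom ≫ ((singleFunctors C).shiftIso (n + 1) (-(n + 1)) 0 (by lia)).hom.app Y)
    (-(n + 1)) (by lia)
  refine ⟨X', p, hp, homEquiv.injective ?_⟩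
  have h2 : (homEquiv ((mk₀ p).comp e (zero_add (n + 1)))) = (singleFunctor C 0).map p ≫ e.hom :=
    (singleFunctor_map_comp_hom _ _).symm
  rw [h2, ← cancel_mono (((singleFunctors C).shiftIso (n + 1) (-(n + 1)) 0 (by lia)).hom.app Y)]
  refine (Category.assoc _ _ _).trans (h.trans (Eq.symm ?_))
  exact (congrArg (· ≫ _) (zero_hom X' Y (n + 1))).trans Limits.zero_comp

end CategoryTheory.Abelian.Ext

variable {D : Type u₂} [Category.{v₂} D] [Abelian D]

/-- A fully faithful exact functor induces bijections on `Ext`-groups if the extension classes of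
positive degree in the target are killed by images of epimorphisms of the source. -/
lemma CategoryTheory.Functor.mapExt_bijective_of_effaceable (F : C ⥤ D) [F.Additive]
    [PreservesFiniteLimits F] [PreservesFiniteColimits F] [F.Full] [F.Faithful] [HasExt.{w} C]
    [HasExt.{w'} D]
    (hF : ∀ (X Y : C) (n : ℕ) (e : Ext.{w'} (F.obj X) (F.obj Y) (n + 1)), ∃ (X' : C) (p : X' ⟶ X),
      Epi p ∧ (Ext.mk₀ (F.map p)).comp e (zero_add _) = 0)
    (X Y : C) (n : ℕ) : Function.Bijective (F.mapExtAddHom X Y n) := by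
  induction n generalizing X with
  | zero => simpa [Ext.mapExactFunctor₀] using! ⟨Faithful.map_injective, Full.map_surjective⟩
  | succ n hn =>
    have hS {X' : C} (p : X' ⟶ X) [Epi p] :
        (ShortComplex.mk _ _ (kernel.condition p)).ShortExact :=
      { exact := ShortComplex.exact_kernel p }
    -- Shift degrees along `0 → ker p → X' → X → 0`. For injectivity, `a` is the boundary of some
    -- `a'`; if `a` dies in the target, the image of `a'` extends to `F X'`, and by induction `a'`
    -- itself extends to `X'`, so its boundary is zero. Surjectivity lifts a preimage of `e` under
    -- the boundary; only here is `hF` used.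
    refine ⟨(injective_iff_map_eq_zero _).2 fun a ha => ?_, fun e => ?_⟩
    · obtain ⟨X', p, _, hpa⟩ := Ext.exists_epi_mk₀_comp_eq_zero a
      obtain ⟨a', rfl⟩ := Ext.contravariant_sequence_exact₃ (hS p) _ a hpa (add_comm 1 n)
      rw [Functor.mapExtAddHom_apply, Ext.mapExactFunctor_comp, Ext.mapExactFunctor_extClass] at ha
      obtain ⟨b, hb⟩ := Ext.contravariant_sequence_exact₁ ((hS p).map_of_exact F) _ _ _ ha
      obtain ⟨b', rfl⟩ := (hn X').2 b
      obtain rfl : (Ext.mk₀ (kernel.ι p)).comp b' (zero_add n) = a' := (hn _).1 <| by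
        rw [Functor.mapExtAddHom_apply, Ext.mapExactFunctor_comp, Ext.mapExactFunctor_mk₀]
        exact hb
      exact (hS p).extClass_comp_assoc _
    · obtain ⟨X', p, _, hpe⟩ := hF X Y n e
      obtain ⟨e', rfl⟩ := Ext.contravariant_sequence_exact₃ ((hS p).map_of_exact F) _ e hpe
        (add_comm 1 n)
      obtain ⟨a', rfl⟩ := (hn _).2 e'
      refine ⟨(hS p).extClass.comp a' (add_comm 1 n), ?_⟩
      rw [Functor.mapExtAddHom_apply, Ext.mapExactFunctor_comp, Ext.mapExactFunctor_extClass]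
      rfl

end Effaceability

/-! ### Dimension shifting and acyclic resolutions -/

section Acyclic

universe w u₁ v₁

variable {C : Type u₁} [Category.{v₁} C] [Abelian C]

namespace CategoryTheory.ShortComplex.ShortExact

variable [HasExt.{w} C] {S : ShortComplex C}

lemma subsingleton_ext_X₃ {n : ℕ} (hS : S.ShortExact) (L : C)
    (h₂ : Subsingleton (Ext L S.X₂ n))
    (h₁ : Subsingleton (Ext L S.X₁ (n + 1))) : Subsingleton (Ext L S.X₃ n) :=
  subsingleton_of_forall_eq 0 fun x => by
    obtain ⟨y, rfl⟩ := Ext.covariant_sequence_exact₃ L hS x rfl (Subsingleton.elim _ _)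
    rw [Subsingleton.elim y 0, Ext.zero_comp]

lemma subsingleton_ext_X₁ {n : ℕ} (hS : S.ShortExact) (L : C)
    (h₃ : Subsingleton (Ext L S.X₃ n))
    (h₂ : Subsingleton (Ext L S.X₂ (n + 1))) : Subsingleton (Ext L S.X₁ (n + 1)) :=
  subsingleton_of_forall_eq 0 fun x => by
    obtain ⟨y, rfl⟩ := Ext.covariant_sequence_exact₁ L hS x (Subsingleton.elim _ _) rfl
    rw [Subsingleton.elim y 0, Ext.zero_comp]

lemma exists_lift_of_subsingleton_ext (hS : S.ShortExact) (L : C)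
    (h : Subsingleton (Ext L S.X₁ 1)) (f : L ⟶ S.X₃) :
    ∃ g : L ⟶ S.X₂, g ≫ S.g = f := by
  obtain ⟨y, hy⟩ := Ext.covariant_sequence_exact₃ L hS (Ext.mk₀ f) rfl (Subsingleton.elim _ _)
  obtain ⟨g, rfl⟩ := (Ext.mk₀_bijective _ _).2 y
  exact ⟨g, (Ext.mk₀_bijective _ _).1 (by rw [← hy, Ext.mk₀_comp_mk₀])⟩

lemma subsingleton_ext_one_of_exists_lift (hS : S.ShortExact) (L : C)
    (h₂ : Subsingleton (Ext L S.X₂ 1))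
    (h : ∀ f : L ⟶ S.X₃, ∃ g : L ⟶ S.X₂, g ≫ S.g = f) : Subsingleton (Ext L S.X₁ 1) :=
  subsingleton_of_forall_eq 0 fun x => by
    obtain ⟨y, rfl⟩ := Ext.covariant_sequence_exact₁ L hS x (Subsingleton.elim _ _) rfl
    obtain ⟨f, rfl⟩ := (Ext.mk₀_bijective _ _).2 y
    obtain ⟨g, rfl⟩ := h f
    rw [← Ext.mk₀_comp_mk₀, Ext.comp_assoc_of_second_deg_zero, hS.comp_extClass, Ext.comp_zero]

end CategoryTheory.ShortComplex.ShortExact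

/-- Splits the first step off a resolution: the cycles `kernel (d 1)` have the shifted complex as
their own resolution, which drives the induction below. -/
lemma shortExact_kernelLift {I : ℕ → C} (d : ∀ k, I k ⟶ I (k + 1)) (hd : ∀ k, d k ≫ d (k + 1) = 0)
    (hex : ∀ k, (ShortComplex.mk _ _ (hd k)).Exact) {M : C} (i : M ⟶ I 0) [Mono i]
    (hi : i ≫ d 0 = 0) (hiex : (ShortComplex.mk _ _ hi).Exact) :
    (ShortComplex.mk i (kernel.lift (d 1) (d 0) (hd 0)) (by
      rw [← cancel_mono (kernel.ι (d 1))]; simpa using hi)).ShortExact where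
  exact := by
    let φ : ShortComplex.mk i (kernel.lift (d 1) (d 0) (hd 0)) (by
        rw [← cancel_mono (kernel.ι (d 1))]; simpa using hi) ⟶ ShortComplex.mk _ _ hi :=
      { τ₁ := 𝟙 _, τ₂ := 𝟙 _, τ₃ := kernel.ι (d 1) }
    exact (ShortComplex.exact_iff_of_epi_of_isIso_of_mono φ).2 hiex
  epi_g := (hex 0).epi_kernelLift

/-- A resolution whose terms are acyclic for `Ext L` detects the vanishing of `Ext L`. -/
lemma CategoryTheory.Abelian.Ext.subsingleton_iff_of_acyclic_resolution [HasExt.{w} C]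
    (L : C) (n : ℕ) (I : ℕ → C)
    (d : ∀ k, I k ⟶ I (k + 1)) (hd : ∀ k, d k ≫ d (k + 1) = 0)
    (hex : ∀ k, (ShortComplex.mk _ _ (hd k)).Exact)
    (hI : ∀ k j, Subsingleton (Ext L (I k) (j + 1))) {M : C} (i : M ⟶ I 0) [Mono i]
    (hi : i ≫ d 0 = 0) (hiex : (ShortComplex.mk _ _ hi).Exact) :
    Subsingleton (Ext L M (n + 1)) ↔
      ∀ f : L ⟶ I (n + 1), f ≫ d (n + 1) = 0 → ∃ g : L ⟶ I n, g ≫ d n = f := by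
  induction n generalizing I M with
  | zero =>
    have hS := shortExact_kernelLift d hd hex i hi hiex
    refine ⟨fun h f hf => ?_, fun h => hS.subsingleton_ext_one_of_exists_lift L (hI 0 0) fun f => ?_⟩
    · obtain ⟨g, hg⟩ := hS.exists_lift_of_subsingleton_ext L h (kernel.lift _ f hf)
      exact ⟨g, by simpa using congr($hg ≫ kernel.ι (d 1))⟩
    · obtain ⟨g, hg⟩ := h (f ≫ kernel.ι (d 1)) (by simp)
      exact ⟨g, by rw [← cancel_mono (kernel.ι (d 1))]; simpa using hg⟩
  | succ n ih =>
    have hS := shortExact_kernelLift d hd hex i hi hiex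
    rw [← ih (fun k => I (k + 1)) (fun k => d (k + 1)) (fun k => hd (k + 1))
      (fun k => hex (k + 1)) (fun k => hI (k + 1)) (kernel.ι (d 1)) (kernel.condition _)
      (ShortComplex.exact_kernel _)]
    exact ⟨fun h => hS.subsingleton_ext_X₃ L (hI 0 n) h,
      fun h => hS.subsingleton_ext_X₁ L h (hI 0 (n + 1))⟩

end Acyclic

/-! ### Exactness of inclusions of full subcategories -/

section ExactInclusions

variable {C : Type*} [Category* C] [Abelian C] (P Q : ObjectProperty C)
  [P.ContainsZero] [P.IsClosedUnderKernels] [P.IsClosedUnderCokernels]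
  [P.IsClosedUnderFiniteProducts]
  [Q.ContainsZero] [Q.IsClosedUnderKernels] [Q.IsClosedUnderCokernels]
  [Q.IsClosedUnderFiniteProducts]

lemma CategoryTheory.ObjectProperty.preservesFiniteLimits_ι : PreservesFiniteLimits P.ι := by
  have := P.preservesKernels_ι
  have : P.ι.Additive := inferInstance
  exact P.ι.preservesFiniteLimits_of_preservesKernels

lemma CategoryTheory.ObjectProperty.preservesFiniteColimits_ι : PreservesFiniteColimits P.ι := by
  have := P.preservesCokernels_ι
  exact P.ι.preservesFiniteColimits_of_preservesCokernels

lemma CategoryTheory.ObjectProperty.preservesFiniteLimits_ιOfLE (h : P ≤ Q) :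
    PreservesFiniteLimits (ObjectProperty.ιOfLE h) := by
  have : PreservesFiniteLimits (ObjectProperty.ιOfLE h ⋙ Q.ι) := P.preservesFiniteLimits_ι
  have := Q.preservesFiniteLimits_ι
  exact ⟨fun J _ _ => preservesLimitsOfShape_of_reflects_of_preserves _ Q.ι⟩

lemma CategoryTheory.ObjectProperty.preservesFiniteColimits_ιOfLE (h : P ≤ Q) :
    PreservesFiniteColimits (ObjectProperty.ιOfLE h) := by
  have : PreservesFiniteColimits (ObjectProperty.ιOfLE h ⋙ Q.ι) := P.preservesFiniteColimits_ι
  have := Q.preservesFiniteColimits_ι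
  exact ⟨fun J _ _ => preservesColimitsOfShape_of_reflects_of_preserves _ Q.ι⟩

end ExactInclusions

/-! ### The abelian category of discrete representations -/

section DiscreteReps

variable {k : Type v} [CommRing k] {Γ : Type u} [Group Γ] [TopologicalSpace Γ]

/-- The property of a `k`-linear `Γ`-module of having open stabilizers. -/
def openStabilizers (k : Type v) [CommRing k] (Γ : Type u) [Group Γ] [TopologicalSpace Γ] :
    ObjectProperty (Rep.{u} k Γ) :=
  fun M => ∀ m : M.V, IsOpen {g : Γ | M.ρ g m = m}

/-- The stabilizer of `m` is the finite intersection of the stabilizers of its images. Subobjects,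
finite products and the zero object are all instances. -/
lemma openStabilizers_of_jointly_injective {J : Type*} [Finite J] {A : Rep.{u} k Γ}
    {B : J → Rep.{u} k Γ} (f : ∀ j, A ⟶ B j)
    (hf : ∀ x y : A.V, (∀ j, (f j).hom x = (f j).hom y) → x = y)
    (hB : ∀ j, openStabilizers k Γ (B j)) : openStabilizers k Γ A := fun m => by
  have : {g : Γ | A.ρ g m = m} =
      ⋂ j, {g : Γ | (B j).ρ g ((f j).hom m) = (f j).hom m} := by
    ext g
    simp only [Set.mem_ofPred_eq, Set.mem_iInter, ← Rep.hom_comm_apply]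
    exact ⟨fun h j => by rw [h], fun h => hf _ _ h⟩
  rw [this]
  exact isOpen_iInter_of_finite fun j => hB j _

lemma openStabilizers_of_surjective [IsTopologicalGroup Γ] {A B : Rep.{u} k Γ}
    (f : A ⟶ B) (hf : Function.Surjective f.hom) (hA : openStabilizers k Γ A) :
    openStabilizers k Γ B := fun m => by
  obtain ⟨a, rfl⟩ := hf m
  let S : Subgroup Γ :=
    { carrier := {g | B.ρ g (f.hom a) = f.hom a}
      one_mem' := by simp
      mul_mem' := fun {g h} hg hh => by
        simp only [Set.mem_ofPred_eq] at hg hh ⊢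
        have : B.ρ (g * h) (f.hom a) = B.ρ g (B.ρ h (f.hom a)) := by rw [map_mul]; rfl
        rw [this, hh, hg]
      inv_mem' := fun {g} hg => by
        simp only [Set.mem_ofPred_eq] at hg ⊢
        conv_lhs => rw [← hg]
        simp }
  change IsOpen (S : Set Γ)
  refine S.isOpen_of_mem_nhds (g := 1) (Filter.mem_of_superset
    ((hA a).mem_nhds (by simp)) fun g hg => ?_)
  change B.ρ g (f.hom a) = f.hom a
  rw [← Rep.hom_comm_apply, show A.ρ g a = a from hg]

instance : (openStabilizers k Γ).IsClosedUnderSubobjects where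
  prop_of_mono f _ hY :=
    openStabilizers_of_jointly_injective (J := Unit) (fun _ => f)
      (fun _ _ h => (Rep.mono_iff_injective f).1 inferInstance (h ())) fun _ => hY

instance [IsTopologicalGroup Γ] : (openStabilizers k Γ).IsClosedUnderQuotients where
  prop_of_epi f _ hX :=
    openStabilizers_of_surjective f ((Rep.epi_iff_surjective f).1 inferInstance) hX

instance : (openStabilizers k Γ).IsClosedUnderFiniteProducts where
  isClosedUnderLimitsOfShape J _ := ⟨by
    rintro X ⟨p⟩
    exact openStabilizers_of_jointly_injective (fun j => p.π.app ⟨j⟩)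
      (fun x y h => Concrete.isLimit_ext _
        (isLimitOfPreserves (forget₂ (Rep.{u} k Γ) (ModuleCat.{u} k)) p.isLimit) x y
        fun j => h j.as)
      fun j => p.prop_diag_obj ⟨j⟩⟩

instance : (openStabilizers k Γ).ContainsZero where
  exists_zero := ⟨Rep.of (Representation.trivial k Γ PUnit.{u + 1}), by
    rw [IsZero.iff_id_eq_zero]; ext, by
    exact openStabilizers_of_jointly_injective (J := Empty) (B := fun j => j.elim)
      (fun j => j.elim) (fun _ _ _ => rfl) fun j => j.elim⟩

/-- The category of `k`-linear `Γ`-modules with open stabilizers. -/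
abbrev DiscRep (k : Type v) [CommRing k] (Γ : Type u) [Group Γ] [TopologicalSpace Γ] :=
  (openStabilizers k Γ).FullSubcategory

namespace DiscRep

/-- The underlying module of a discrete representation. -/
abbrev V (M : DiscRep k Γ) : Type u := M.obj.V

/-- The action of the group on a discrete representation. -/
def act (M : DiscRep k Γ) (g : Γ) : M.V →+ M.V := (M.obj.ρ g).toAddMonoidHom

/-- The additive map underlying a morphism of discrete representations. -/
def fn {M N : DiscRep k Γ} (f : M ⟶ N) : M.V →+ N.V := f.hom.hom.toLinearMap.toAddMonoidHom

/-- A morphism of discrete representations from an equivariant linear map. -/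
def mkHom {M N : DiscRep k Γ} (f : M.V →+ N.V) (hk : ∀ (c : k) m, f (c • m) = c • f m)
    (hf : ∀ g m, f (M.act g m) = N.act g (f m)) : M ⟶ N :=
  ObjectProperty.homMk (Rep.ofHom ⟨{ f with map_smul' := hk }, fun g => LinearMap.ext (hf g)⟩)

@[simp]
lemma act_one (M : DiscRep k Γ) (m : M.V) : M.act 1 m = m := by
  simp [act]

lemma act_mul (M : DiscRep k Γ) (g h : Γ) (m : M.V) : M.act (g * h) m = M.act g (M.act h m) := by
  simp [act]

@[simp]
lemma act_inv_act (M : DiscRep k Γ) (g : Γ) (m : M.V) : M.act g⁻¹ (M.act g m) = m := by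
  rw [← act_mul]; simp

@[simp]
lemma act_act_inv (M : DiscRep k Γ) (g : Γ) (m : M.V) : M.act g (M.act g⁻¹ m) = m := by
  rw [← act_mul]; simp

lemma isOpen_stabilizer (M : DiscRep k Γ) (m : M.V) : IsOpen {g : Γ | M.act g m = m} :=
  M.property m

lemma fn_act {M N : DiscRep k Γ} (f : M ⟶ N) (g : Γ) (m : M.V) :
    fn f (M.act g m) = N.act g (fn f m) :=
  Rep.hom_comm_apply f.hom g m

lemma hom_ext {M N : DiscRep k Γ} {f g : M ⟶ N} (h : ∀ m, fn f m = fn g m) : f = g := by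
  apply ObjectProperty.hom_ext
  apply Rep.hom_ext
  ext m
  exact h m

@[simp]
lemma fn_comp {M N P : DiscRep k Γ} (f : M ⟶ N) (g : N ⟶ P) (m : M.V) :
    fn (f ≫ g) m = fn g (fn f m) := rfl

@[simp]
lemma fn_zero {M N : DiscRep k Γ} (m : M.V) : fn (0 : M ⟶ N) m = 0 := rfl

variable [IsTopologicalGroup Γ]

lemma preservesFiniteLimits_forget :
    PreservesFiniteLimits ((openStabilizers k Γ).ι ⋙ forget₂ (Rep.{u} k Γ) (ModuleCat.{u} k)) := by
  have := (openStabilizers k Γ).preservesFiniteLimits_ι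
  infer_instance

lemma preservesFiniteColimits_forget : PreservesFiniteColimits
    ((openStabilizers k Γ).ι ⋙ forget₂ (Rep.{u} k Γ) (ModuleCat.{u} k)) := by
  have := (openStabilizers k Γ).preservesFiniteColimits_ι
  infer_instance

lemma exact_iff (S : ShortComplex (DiscRep k Γ)) :
    S.Exact ↔ ∀ x, fn S.g x = 0 → ∃ y, fn S.f y = x := by
  have := preservesFiniteLimits_forget (k := k) (Γ := Γ)
  have := preservesFiniteColimits_forget (k := k) (Γ := Γ)
  rw [← S.exact_map_iff_of_faithful
    ((openStabilizers k Γ).ι ⋙ forget₂ (Rep.{u} k Γ) (ModuleCat.{u} k)),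
    ShortComplex.moduleCat_exact_iff]
  rfl

lemma mono_iff {M N : DiscRep k Γ} (f : M ⟶ N) : Mono f ↔ Function.Injective (fn f) := by
  have := preservesFiniteLimits_forget (k := k) (Γ := Γ)
  rw [← ((openStabilizers k Γ).ι ⋙ forget₂ (Rep.{u} k Γ) (ModuleCat.{u} k)).mono_map_iff_mono,
    ModuleCat.mono_iff_injective]
  rfl

lemma epi_iff {M N : DiscRep k Γ} (f : M ⟶ N) : Epi f ↔ Function.Surjective (fn f) := by
  have := preservesFiniteColimits_forget (k := k) (Γ := Γ)
  rw [← ((openStabilizers k Γ).ι ⋙ forget₂ (Rep.{u} k Γ) (ModuleCat.{u} k)).epi_map_iff_epi,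
    ModuleCat.epi_iff_surjective]
  rfl

lemma shortExact_iff (S : ShortComplex (DiscRep k Γ)) :
    S.ShortExact ↔ Function.Injective (fn S.f) ∧ Function.Surjective (fn S.g) ∧
      ∀ x, fn S.g x = 0 → ∃ y, fn S.f y = x := by
  rw [← mono_iff, ← epi_iff, ← exact_iff]
  exact ⟨fun h => ⟨h.mono_f, h.epi_g, h.exact⟩, fun ⟨_, _, h⟩ => ⟨h⟩⟩

lemma pullback_ext {X Y Z : DiscRep k Γ} (f : X ⟶ Z) (g : Y ⟶ Z) (a b : (pullback f g).V)
    (h₁ : fn (pullback.fst f g) a = fn (pullback.fst f g) b)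
    (h₂ : fn (pullback.snd f g) a = fn (pullback.snd f g) b) : a = b := by
  have := preservesFiniteLimits_forget (k := k) (Γ := Γ)
  refine Concrete.isLimit_ext _ (isLimitOfPreserves ((openStabilizers k Γ).ι ⋙
    forget₂ (Rep.{u} k Γ) (ModuleCat.{u} k)) (limit.isLimit (cospan f g))) a b ?_
  rintro (_ | _ | _)
  · have h : limit.π (cospan f g) WalkingCospan.one = pullback.fst f g ≫ f :=
      (limit.w (cospan f g) WalkingCospan.Hom.inl).symm
    change fn (limit.π (cospan f g) WalkingCospan.one) a =
      fn (limit.π (cospan f g) WalkingCospan.one) b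
    rw [h]
    exact congrArg (fn f) h₁
  · exact h₁
  · exact h₂

end DiscRep

end DiscreteReps

section DiscMod

variable {Γ : Type u} [Group Γ] [TopologicalSpace Γ]

/-- The category of discrete `Γ`-modules. -/
abbrev DiscMod (Γ : Type u) [Group Γ] [TopologicalSpace Γ] : Type (u + 1) := DiscRep ℤ Γ

/-- The `ℤ`-module structures are arbitrary because an object of `Rep ℤ Γ` carries its own, which
need not be the canonical instance. -/
lemma AddMonoidHom.map_int_smul {A B : Type*} [AddCommGroup A] [AddCommGroup B]
    (hA : Module ℤ A) (hB : Module ℤ B) (f : A →+ B) (c : ℤ) (a : A) :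
    f (hA.toSMul.smul c a) = hB.toSMul.smul c (f a) := by
  have h := @map_intCast_smul A B _ _ _ _ _ f ℤ ℤ _ _ hA hB c a
  simpa using! h

namespace DiscMod

/-- A morphism of discrete modules from an equivariant additive map. -/
def mkHom {M N : DiscMod Γ} (f : M.V →+ N.V) (hf : ∀ g m, f (M.act g m) = N.act g (f m)) :
    M ⟶ N :=
  DiscRep.mkHom f (AddMonoidHom.map_int_smul _ _ f) hf

end DiscMod

end DiscMod

/-! ### Coinduced modules and injective embeddings -/

section Coinduction

lemma isOpen_setOf_forall_of_compactSpace {X Y : Type*} [TopologicalSpace X] [TopologicalSpace Y]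
    [CompactSpace Y] {U : Set (X × Y)} (hU : IsOpen U) : IsOpen {x | ∀ y, (x, y) ∈ U} := by
  have : {x | ∀ y, (x, y) ∈ U} = (Prod.fst '' Uᶜ)ᶜ := by
    ext x
    simp
  rw [this]
  exact (isClosedMap_fst_of_compactSpace _ hU.isClosed_compl).isOpen_compl

/-- Agreeing with `f` at one point is an open condition since `Y` is discrete, and by compactness of
`X` it stays open when imposed at all points. -/
instance ContinuousMap.discreteTopology_of_compactSpace {X Y : Type*} [TopologicalSpace X]
    [TopologicalSpace Y] [CompactSpace X] [LocallyCompactSpace X] [DiscreteTopology Y] :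
    DiscreteTopology C(X, Y) := by
  refine discreteTopology_iff_isOpen_singleton.2 fun f => ?_
  have : ({f} : Set C(X, Y)) = {h | ∀ x, (h, x) ∈ {p : C(X, Y) × X | p.1 p.2 = f p.2}} := by
    ext h
    simp [ContinuousMap.ext_iff]
  rw [this]
  refine isOpen_setOf_forall_of_compactSpace ?_
  have hc : Continuous fun p : C(X, Y) × X => (p.1 p.2, f p.2) := by fun_prop
  exact (isOpen_discrete {q : Y × Y | q.1 = q.2}).preimage hc

namespace DiscRep

variable {k : Type v} [CommRing k] {Γ : Type u} [Group Γ] [TopologicalSpace Γ]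
  [IsTopologicalGroup Γ]

lemma isLocallyConstant_act (M : DiscRep k Γ) (m : M.V) :
    IsLocallyConstant fun g => M.act g m := by
  refine (IsLocallyConstant.iff_exists_open _).2 fun g =>
    ⟨{h | M.act (g⁻¹ * h) m = m}, (M.isOpen_stabilizer m).preimage (continuous_const_mul g⁻¹),
      by simp, fun h hh => ?_⟩
  change M.act (g⁻¹ * h) m = m at hh
  conv_rhs => rw [← hh, act_mul, act_act_inv]

end DiscRep

namespace TopRep

variable {k : Type v} [CommRing k] [TopologicalSpace k] {Γ : Type u} [Group Γ]
  [TopologicalSpace Γ] [IsTopologicalGroup Γ]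

/-- The action of the group on a topological representation. -/
def act (T : TopRep.{u} k Γ) (g : Γ) : T.V →+ T.V := (T.ρ g).toLinearMap.toAddMonoidHom

@[simp]
lemma act_one (T : TopRep.{u} k Γ) (t : T.V) : T.act 1 t = t := by
  simp [act]

lemma act_mul (T : TopRep.{u} k Γ) (g h : Γ) (t : T.V) : T.act (g * h) t = T.act g (T.act h t) := by
  simp [act]

/-- A topological representation is discrete if its topology is discrete and it has open
stabilizers. -/
structure IsDiscrete (T : TopRep.{u} k Γ) : Prop where
  discreteTopology : DiscreteTopology T.V
  isOpen_stabilizer : ∀ m : T.V, IsOpen {g : Γ | T.ρ g m = m}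

/-- The discrete representation underlying a discrete topological representation. -/
def toDiscRep (T : TopRep.{u} k Γ) (hT : T.IsDiscrete) : DiscRep k Γ :=
  ⟨Rep.of T.ρ.toRepresentation, hT.isOpen_stabilizer⟩

/-- The morphism of discrete representations underlying a morphism of topological
representations. -/
def toDiscRepMap {T T' : TopRep.{u} k Γ} (hT : T.IsDiscrete) (hT' : T'.IsDiscrete) (f : T ⟶ T') :
    T.toDiscRep hT ⟶ T'.toDiscRep hT' :=
  ObjectProperty.homMk (Rep.ofHom f.hom.toIntertwiningMap)

lemma IsDiscrete.continuous_act {T : TopRep.{u} k Γ} (hT : T.IsDiscrete) :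
    Continuous fun p : Γ × T.V => T.act p.1 p.2 := by
  have := hT.discreteTopology
  rw [continuous_prod_of_discrete_right]
  intro t
  have h : IsLocallyConstant fun g => T.act g t :=
    DiscRep.isLocallyConstant_act (T.toDiscRep hT) t
  exact h.continuous

/-- The evaluation of an element of a coinduced representation. -/
def coindEval (T : TopRep.{u} k Γ) (x : Γ) : T.coind₁.V →+ T.V where
  toFun f := (show C(Γ, T.V) from f) x
  map_zero' := rfl
  map_add' _ _ := rfl

lemma coind_ext {T : TopRep.{u} k Γ} {f f' : T.coind₁.V}
    (h : ∀ x, T.coindEval x f = T.coindEval x f') : f = f' :=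
  ContinuousMap.ext h

lemma continuous_coindEval (T : TopRep.{u} k Γ) (f : T.coind₁.V) :
    Continuous fun x => T.coindEval x f :=
  (show C(Γ, T.V) from f).continuous

/-- The element of a coinduced representation attached to a continuous function. -/
def coindMk (T : TopRep.{u} k Γ) (f : Γ → T.V) (hf : Continuous f) : T.coind₁.V :=
  (⟨f, hf⟩ : C(Γ, T.V))

lemma finite_range_coindEval [CompactSpace Γ] {T : TopRep.{u} k Γ} (hT : T.IsDiscrete)
    (f : T.coind₁.V) : (Set.range fun x => T.coindEval x f).Finite :=
  have := hT.discreteTopology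
  (isCompact_range (T.continuous_coindEval f)).finite_of_discrete

lemma IsDiscrete.coind₁ [CompactSpace Γ] {T : TopRep.{u} k Γ} (hT : T.IsDiscrete) :
    T.coind₁.IsDiscrete where
  discreteTopology :=
    have := hT.discreteTopology
    inferInstanceAs (DiscreteTopology C(Γ, T.V))
  isOpen_stabilizer f := by
    have := hT.discreteTopology
    have h : {g : Γ | T.coind₁.ρ g f = f} = {g | ∀ x, (g, x) ∈ {p : Γ × Γ |
        T.act p.1 (T.coindEval (p.1⁻¹ * p.2) f) = T.coindEval p.2 f}} := by
      ext g
      exact ⟨fun hg x => congrArg (T.coindEval x) hg, fun hg => coind_ext hg⟩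
    rw [h]
    refine isOpen_setOf_forall_of_compactSpace ?_
    have hc : Continuous fun p : Γ × Γ =>
        (T.act p.1 (T.coindEval (p.1⁻¹ * p.2) f), T.coindEval p.2 f) :=
      (hT.continuous_act.comp (continuous_fst.prodMk ((T.continuous_coindEval f).comp
        (by fun_prop)))).prodMk ((T.continuous_coindEval f).comp continuous_snd)
    exact (isOpen_discrete {q : T.V × T.V | q.1 = q.2}).preimage hc

lemma IsDiscrete.resolutionX [CompactSpace Γ] {T : TopRep.{u} k Γ} (hT : T.IsDiscrete) (n : ℕ) :
    (T.resolutionX n).IsDiscrete := by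
  induction n with
  | zero => exact hT
  | succ n ih => exact ih.coind₁

end TopRep

/-- A discrete representation, endowed with the discrete topology. -/
def DiscRep.toTopRep {k : Type v} [CommRing k] [TopologicalSpace k] [DiscreteTopology k]
    {Γ : Type u} [Group Γ] [TopologicalSpace Γ] (M : DiscRep k Γ) : TopRep.{u} k Γ :=
  letI : TopologicalSpace M.V := ⊥
  letI : DiscreteTopology M.V := ⟨rfl⟩
  letI : ContinuousSMul k M.V := ⟨continuous_of_discreteTopology⟩
  TopRep.of (ContRepresentation.ofMonoidHom
    { toFun := fun g => ⟨M.obj.ρ g, continuous_of_discreteTopology⟩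
      map_one' := by ext; simp
      map_mul' := fun _ _ => by ext; simp } : ContRepresentation k Γ M.V)

namespace DiscRep

variable {k : Type v} [CommRing k] [TopologicalSpace k] [DiscreteTopology k] {Γ : Type u} [Group Γ]
  [TopologicalSpace Γ] [IsTopologicalGroup Γ]

lemma isDiscrete_toTopRep (M : DiscRep k Γ) : M.toTopRep.IsDiscrete where
  discreteTopology := ⟨rfl⟩
  isOpen_stabilizer := M.property

end DiscRep

namespace DiscMod

variable {Γ : Type u} [Group Γ] [TopologicalSpace Γ] [IsTopologicalGroup Γ] [CompactSpace Γ]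

/-- The coinduced module `C(Γ, T)` of a discrete module `T`. -/
abbrev coind {T : TopRep.{u} ℤ Γ} (hT : T.IsDiscrete) : DiscMod Γ := T.coind₁.toDiscRep hT.coind₁

/-- The equivariant map to a coinduced module attached to an additive map. -/
def coindLift (N : DiscMod Γ) {T : TopRep.{u} ℤ Γ} (hT : T.IsDiscrete) (ψ : N.V →+ T.V) :
    N ⟶ coind hT :=
  mkHom
    -- Frobenius reciprocity: equivariance forces this formula once the value at `1` is `ψ n`. The
    -- map `ψ` itself need not be equivariant.
    { toFun := fun n => T.coindMk (fun x => T.act x (ψ (N.act x⁻¹ n)))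
        (hT.continuous_act.comp (continuous_id.prodMk
          (((N.isLocallyConstant_act n).comp ψ).continuous.comp continuous_inv)))
      map_zero' := TopRep.coind_ext fun x => by
        change T.act x (ψ (N.act x⁻¹ 0)) = 0
        simp
      map_add' := fun m n => TopRep.coind_ext fun x => by
        change T.act x (ψ (N.act x⁻¹ (m + n))) =
          T.act x (ψ (N.act x⁻¹ m)) + T.act x (ψ (N.act x⁻¹ n))
        simp }
    fun g n => TopRep.coind_ext fun x => by
      change T.act x (ψ (N.act x⁻¹ (N.act g n))) =
        T.act g (T.act (g⁻¹ * x) (ψ (N.act (g⁻¹ * x)⁻¹ n)))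
      rw [← TopRep.act_mul, ← DiscRep.act_mul]
      simp

@[simp]
lemma coindEval_coindLift (N : DiscMod Γ) {T : TopRep.{u} ℤ Γ} (hT : T.IsDiscrete)
    (ψ : N.V →+ T.V) (x : Γ) (n : N.V) :
    T.coindEval x (DiscRep.fn (coindLift N hT ψ) n) = T.act x (ψ (N.act x⁻¹ n)) := rfl

lemma coindLift_injective {N : DiscMod Γ} {T : TopRep.{u} ℤ Γ} (hT : T.IsDiscrete)
    {ψ : N.V →+ T.V} (hψ : Function.Injective ψ) :
    Function.Injective (DiscRep.fn (coindLift N hT ψ)) := fun a b h => hψ <| by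
  have := congrArg (T.coindEval 1) h
  rwa [coindEval_coindLift, coindEval_coindLift, TopRep.act_one, TopRep.act_one, inv_one,
    DiscRep.act_one, DiscRep.act_one] at this

lemma coind_hom_ext {N : DiscMod Γ} {T : TopRep.{u} ℤ Γ} {hT : T.IsDiscrete}
    {φ φ' : N ⟶ coind hT}
    (h : ∀ n, T.coindEval 1 (DiscRep.fn φ n) = T.coindEval 1 (DiscRep.fn φ' n)) : φ = φ' := by
  have key (φ : N ⟶ coind hT) (n : N.V) (x : Γ) : T.coindEval x (DiscRep.fn φ n) =
      T.act x (T.coindEval 1 (DiscRep.fn φ (N.act x⁻¹ n))) := by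
    rw [DiscRep.fn_act]
    change _ = T.act x (T.act x⁻¹ (T.coindEval (x⁻¹⁻¹ * 1) (DiscRep.fn φ n)))
    rw [← TopRep.act_mul]
    simp
  refine DiscRep.hom_ext fun n => TopRep.coind_ext fun x => ?_
  rw [key, key φ', h]

/-- An abelian group is divisible if multiplication by every nonzero natural number is
surjective. -/
def IsDivisible (A : Type*) [AddCommGroup A] : Prop := ∀ n : ℕ, n ≠ 0 → ∀ a : A, ∃ b : A, n • b = a

lemma IsDivisible.exists_extension {A : Type u} [AddCommGroup A] (hA : IsDivisible A) {M N : Type u}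
    [AddCommGroup M] [AddCommGroup N] (i : M →+ N) (hi : Function.Injective i) (f : M →+ A) :
    ∃ g : N →+ A, ∀ m, g (i m) = f m := by
  let : DivisibleBy A ℕ := divisibleByOfSMulRightSurj A ℕ fun {n} hn a => hA n hn a
  let : DivisibleBy A ℤ := AddGroup.divisibleByIntOfDivisibleByNat A
  have : Mono (AddCommGrpCat.ofHom i) := (AddCommGrpCat.mono_iff_injective _).2 hi
  have := AddCommGrpCat.injective_of_divisible A
  refine ⟨(Injective.factorThru (AddCommGrpCat.ofHom f) (AddCommGrpCat.ofHom i)).hom, fun m => ?_⟩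
  exact congr($(Injective.comp_factorThru (AddCommGrpCat.ofHom f) (AddCommGrpCat.ofHom i)) m)

lemma IsDivisible.of_surjective {A B : Type*} [AddCommGroup A] [AddCommGroup B]
    (hA : IsDivisible A) (f : A →+ B) (hf : Function.Surjective f) : IsDivisible B := fun n hn b => by
  obtain ⟨a, rfl⟩ := hf b
  obtain ⟨c, rfl⟩ := hA n hn a
  exact ⟨f c, (map_nsmul f n c).symm⟩

/-- Morphisms into `coind hT` are additive maps into `T.V`, by evaluation at `1`, and these extend
along injections because `T.V` is divisible. -/
lemma injective_coind {T : TopRep.{u} ℤ Γ} (hT : T.IsDiscrete) (hd : IsDivisible T.V) :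
    Injective (coind hT) where
  factors {M N} g i _ := by
    obtain ⟨ψ, hψ⟩ := hd.exists_extension (DiscRep.fn i) ((DiscRep.mono_iff i).1 inferInstance)
      ((T.coindEval 1).comp (DiscRep.fn g))
    refine ⟨coindLift N hT ψ, coind_hom_ext fun m => ?_⟩
    rw [DiscRep.fn_comp, coindEval_coindLift, TopRep.act_one, inv_one, DiscRep.act_one]
    exact hψ m

lemma isDivisible_coind {T : TopRep.{u} ℤ Γ} (hT : T.IsDiscrete) (hd : IsDivisible T.V) :
    IsDivisible (coind hT).V := fun n hn f => by
  have := hT.discreteTopology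
  choose s hs using hd n hn
  refine ⟨T.coindMk (fun x => s (T.coindEval x f))
    (continuous_of_discreteTopology.comp (T.continuous_coindEval f)), TopRep.coind_ext fun x => ?_⟩
  change n • s (T.coindEval x f) = _
  rw [hs]

/-- An abelian group is `ℓ`-primary if every element is killed by a power of `ℓ`. -/
def IsPrimary (ℓ : ℕ) (A : Type*) [AddCommGroup A] : Prop := ∀ a : A, ∃ n : ℕ, ℓ ^ n • a = 0

lemma pow_smul_eq_zero_of_le {A : Type*} [AddCommGroup A] {ℓ m n : ℕ} {a : A} (h : ℓ ^ m • a = 0)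
    (hmn : m ≤ n) : ℓ ^ n • a = 0 := by
  rw [← Nat.sub_add_cancel hmn, pow_add, mul_smul, h, smul_zero]

lemma IsPrimary.exists_pow_of_finite {ℓ : ℕ} {A : Type*} [AddCommGroup A] (hA : IsPrimary ℓ A)
    {s : Set A} (hs : s.Finite) : ∃ n : ℕ, ∀ a ∈ s, ℓ ^ n • a = 0 := by
  induction s, hs using Set.Finite.induction_on with
  | empty => exact ⟨0, by simp⟩
  | @insert a s _ _ ih =>
    obtain ⟨n, hn⟩ := ih
    obtain ⟨m, hm⟩ := hA a
    refine ⟨n + m, ?_⟩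
    rintro b (rfl | hb)
    · exact pow_smul_eq_zero_of_le hm (by lia)
    · exact pow_smul_eq_zero_of_le (hn b hb) (by lia)

lemma IsPrimary.of_injective {ℓ : ℕ} {A B : Type*} [AddCommGroup A] [AddCommGroup B]
    (hB : IsPrimary ℓ B) (f : A →+ B) (hf : Function.Injective f) : IsPrimary ℓ A := fun a => by
  obtain ⟨n, hn⟩ := hB (f a)
  exact ⟨n, hf (by rw [map_nsmul, hn, map_zero])⟩

lemma IsPrimary.of_surjective {ℓ : ℕ} {A B : Type*} [AddCommGroup A] [AddCommGroup B]
    (hA : IsPrimary ℓ A) (f : A →+ B) (hf : Function.Surjective f) : IsPrimary ℓ B := fun b => by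
  obtain ⟨a, rfl⟩ := hf b
  obtain ⟨n, hn⟩ := hA a
  exact ⟨n, by rw [← map_nsmul, hn, map_zero]⟩

/-- A continuous function from a compact space to a discrete one has finitely many values, so one
power of `ℓ` kills them all. -/
lemma isPrimary_coind {ℓ : ℕ} {T : TopRep.{u} ℤ Γ} (hT : T.IsDiscrete) (hp : IsPrimary ℓ T.V) :
    IsPrimary ℓ (coind hT).V := fun f => by
  obtain ⟨n, hn⟩ := hp.exists_pow_of_finite (TopRep.finite_range_coindEval hT f)
  exact ⟨n, TopRep.coind_ext fun x => hn _ ⟨x, rfl⟩⟩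

/-- The subgroup of elements killed by a power of `ℓ`. -/
def primaryPart (ℓ : ℕ) (A : Type*) [AddCommGroup A] : AddSubgroup A where
  carrier := {a | ∃ n : ℕ, ℓ ^ n • a = 0}
  zero_mem' := ⟨0, by simp⟩
  add_mem' := by
    rintro a b ⟨m, hm⟩ ⟨n, hn⟩
    exact ⟨m + n, by rw [smul_add, pow_smul_eq_zero_of_le hm (by lia),
      pow_smul_eq_zero_of_le hn (by lia), add_zero]⟩
  neg_mem' := by
    rintro a ⟨n, hn⟩
    exact ⟨n, by rw [smul_neg, hn, neg_zero]⟩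

lemma isPrimary_primaryPart (ℓ : ℕ) (A : Type*) [AddCommGroup A] :
    IsPrimary ℓ (primaryPart ℓ A) := fun a => by
  obtain ⟨n, hn⟩ := a.2
  exact ⟨n, Subtype.ext hn⟩

lemma IsDivisible.primaryPart {ℓ : ℕ} (hℓ : ℓ.Prime) {A : Type*} [AddCommGroup A]
    (hA : IsDivisible A) : IsDivisible (primaryPart ℓ A) := by
  rintro n hn ⟨a, k, hk⟩
  obtain ⟨e, m, hm, rfl⟩ := Nat.exists_eq_pow_mul_and_not_dvd hn ℓ hℓ.ne_one
  have hcop : (m : ℤ).gcd (ℓ ^ k : ℕ) = 1 := by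
    rw [Int.gcd_natCast_natCast]
    exact (Nat.Coprime.pow_left k ((Nat.Prime.coprime_iff_not_dvd hℓ).2 hm)).symm
  -- By Bézout `u m + v ℓ ^ k = 1`, so `u • a` is an `m`-th part of `a`; only the division by `ℓ ^
  -- e` uses divisibility of `A`.
  obtain ⟨b, hb⟩ := hA (ℓ ^ e) (pow_ne_zero _ hℓ.ne_zero) (Int.gcdA m (ℓ ^ k : ℕ) • a)
  refine ⟨⟨b, k + e, ?_⟩, Subtype.ext ?_⟩
  · rw [pow_add, mul_smul, hb, smul_comm, hk, smul_zero]
  · change (ℓ ^ e * m) • b = a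
    have h := Int.gcd_eq_gcd_ab m (ℓ ^ k : ℕ)
    rw [hcop] at h
    have h2 := congr($h • a)
    rw [add_smul, mul_smul, mul_comm ((ℓ ^ k : ℕ) : ℤ), mul_smul, natCast_zsmul _ (ℓ ^ k),
      hk, smul_zero, add_zero, natCast_zsmul, one_smul] at h2
    rw [mul_comm, mul_smul, hb, ← natCast_zsmul]
    exact h2.symm

/-- A discrete module with trivial action. -/
def trivial (Γ : Type u) [Group Γ] [TopologicalSpace Γ] (A : Type u) [AddCommGroup A] : DiscMod Γ :=
  ⟨Rep.trivial ℤ Γ A, fun m => by simp⟩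

/-- Extend the map `1 ↦ a` on the integers along multiplication by `n`. -/
lemma isDivisible_of_injective (J : AddCommGrpCat.{u}) [Injective J] : IsDivisible J := by
  intro n hn a
  let i : ULift.{u} ℤ →+ ULift.{u} ℤ := nsmulAddMonoidHom n
  have hi : Function.Injective i := fun x y h => ULift.ext _ _ <| by
    simpa [i, hn] using congrArg ULift.down h
  have : Mono (AddCommGrpCat.ofHom i) := (AddCommGrpCat.mono_iff_injective _).2 hi
  let f : AddCommGrpCat.of (ULift.{u} ℤ) ⟶ J :=
    AddCommGrpCat.ofHom ((zmultiplesHom J a).comp AddEquiv.ulift.toAddMonoidHom)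
  refine ⟨(Injective.factorThru f (AddCommGrpCat.ofHom i)).hom ⟨1⟩, ?_⟩
  rw [← map_nsmul]
  have h := congr($(Injective.comp_factorThru f (AddCommGrpCat.ofHom i)) ⟨1⟩)
  refine h.trans ?_
  change (1 : ℤ) • a = a
  rw [one_smul]

lemma exists_injective_hom_isDivisible_isPrimary {ℓ : ℕ} (hℓ : ℓ.Prime) (A : Type u)
    [AddCommGroup A] (hA : IsPrimary ℓ A) : ∃ (E : Type u) (_ : AddCommGroup E) (i : A →+ E),
      Function.Injective i ∧ IsDivisible E ∧ IsPrimary ℓ E := by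
  let J := Injective.under (AddCommGrpCat.of A)
  let j : A →+ J := (Injective.ι (AddCommGrpCat.of A)).hom
  have hj : Function.Injective j :=
    (AddCommGrpCat.mono_iff_injective (Injective.ι (AddCommGrpCat.of A))).1 inferInstance
  have hJ : IsDivisible J := isDivisible_of_injective J
  refine ⟨primaryPart ℓ J, inferInstance, j.codRestrict _ fun a => ?_, ?_,
    hJ.primaryPart hℓ, isPrimary_primaryPart ℓ _⟩
  · obtain ⟨n, hn⟩ := hA a
    exact ⟨n, by rw [← map_nsmul, hn, map_zero]⟩
  · exact fun a b h => hj congr(($h : J))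

/-- Every `ℓ`-primary discrete module embeds into an injective, divisible and `ℓ`-primary one. -/
lemma exists_mono_injective {ℓ : ℕ} (hℓ : ℓ.Prime) (M : DiscMod Γ) (hM : IsPrimary ℓ M.V) :
    ∃ (J : DiscMod Γ) (i : M ⟶ J), Mono i ∧ Injective J ∧ IsDivisible J.V ∧ IsPrimary ℓ J.V := by
  obtain ⟨E, _, i, hi, hd, hp⟩ := exists_injective_hom_isDivisible_isPrimary hℓ M.V hM
  have hT := (trivial Γ E).isDiscrete_toTopRep
  exact ⟨coind hT, coindLift M hT i, (DiscRep.mono_iff _).2 (coindLift_injective hT hi),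
    injective_coind hT hd, isDivisible_coind hT hd, isPrimary_coind hT hp⟩

end DiscMod

end Coinduction

/-! ### Acyclicity of coinduced modules -/

section CoinducedAcyclicity

universe w

namespace DiscMod

open DiscRep (fn act fn_act fn_comp)

variable {Γ : Type u} [Group Γ] [TopologicalSpace Γ] [IsTopologicalGroup Γ]

/-- The trivial module `ℤ`. -/
def unit (Γ : Type u) [Group Γ] [TopologicalSpace Γ] : DiscMod Γ := trivial Γ (ULift.{u} ℤ)

/-- The generator of the trivial module `ℤ`. -/
def one (Γ : Type u) [Group Γ] [TopologicalSpace Γ] : (unit Γ).V := (⟨1⟩ : ULift.{u} ℤ)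

/-- The additive map from the trivial module `ℤ` that sends the generator to a given element. -/
def unitMap {A : Type*} [AddCommGroup A] (a : A) : (unit Γ).V →+ A :=
  (zmultiplesHom A a).comp (AddEquiv.ulift (α := ℤ)).toAddMonoidHom

@[simp]
lemma unitMap_one {A : Type*} [AddCommGroup A] (a : A) : unitMap a (one Γ) = a := one_zsmul a

lemma unitMap_ext {A : Type*} [AddCommGroup A] {f g : (unit Γ).V →+ A}
    (h : f (one Γ) = g (one Γ)) (n : (unit Γ).V) : f n = g n := by
  have key (f : ULift.{u} ℤ →+ A) (n : ULift.{u} ℤ) : f n = n.down • f ⟨1⟩ := by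
    rw [← map_zsmul]
    congr 1
    ext
    simp
  exact (key f n).trans ((congrArg _ h).trans (key g n).symm)

/-- The morphism from `ℤ` attached to an invariant element. -/
def unitHom {M : DiscMod Γ} (m : M.V) (hm : ∀ g, M.act g m = m) : unit Γ ⟶ M :=
  mkHom (unitMap m) fun g n => unitMap_ext
    (f := unitMap m) (g := (M.act g).comp (unitMap m)) (by simp [hm]) n

@[simp]
lemma fn_unitHom_one {M : DiscMod Γ} (m : M.V) (hm : ∀ g, M.act g m = m) :
    fn (unitHom m hm) (one Γ) = m := unitMap_one m

lemma unit_hom_ext {M : DiscMod Γ} {f g : unit Γ ⟶ M} (h : fn f (one Γ) = fn g (one Γ)) : f = g :=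
  DiscRep.hom_ext (unitMap_ext h)

lemma act_fn_one {M : DiscMod Γ} (f : unit Γ ⟶ M) (g : Γ) :
    M.act g (fn f (one Γ)) = fn f (one Γ) := by
  rw [← fn_act]
  rfl

variable [CompactSpace Γ]

/-- Every `ℓ`-primary discrete module has a coresolution of length one by an injective module and a
divisible module. -/
lemma exists_shortExact_injective {ℓ : ℕ} (hℓ : ℓ.Prime) (M : DiscMod Γ) (hM : IsPrimary ℓ M.V) :
    ∃ (J Q : DiscMod Γ) (i : M ⟶ J) (p : J ⟶ Q) (w : i ≫ p = 0),
      (ShortComplex.mk i p w).ShortExact ∧ Injective J ∧ IsDivisible J.V ∧ IsPrimary ℓ J.V ∧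
        IsDivisible Q.V ∧ IsPrimary ℓ Q.V := by
  obtain ⟨J, i, _, hJ, hd, hp⟩ := exists_mono_injective hℓ M hM
  have hs : Function.Surjective (fn (cokernel.π i)) := (DiscRep.epi_iff _).1 inferInstance
  exact ⟨J, cokernel i, i, cokernel.π i, cokernel.condition i,
    { exact := ShortComplex.exact_cokernel i }, hJ, hd, hp, hd.of_surjective _ hs,
    hp.of_surjective _ hs⟩

/-- The map between coinduced modules attached to an equivariant map. -/
def coindMap {T T' : TopRep.{u} ℤ Γ} (hT : T.IsDiscrete) (hT' : T'.IsDiscrete)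
    (f : T.V →+ T'.V) : coind hT ⟶ coind hT' :=
  coindLift (coind hT) hT' (f.comp (T.coindEval 1))

lemma coindEval_coindMap {T T' : TopRep.{u} ℤ Γ} (hT : T.IsDiscrete) (hT' : T'.IsDiscrete)
    {f : T.V →+ T'.V} (hf : ∀ g t, f (T.act g t) = T'.act g (f t)) (x : Γ) (c : (coind hT).V) :
    T'.coindEval x (fn (coindMap hT hT' f) c) = f (T.coindEval x c) := by
  refine (coindEval_coindLift _ _ _ _ _).trans ?_
  change T'.act x (f (T.act x⁻¹ (T.coindEval (x⁻¹⁻¹ * 1) c))) = _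
  rw [← hf, ← TopRep.act_mul]
  simp

lemma shortExact_coindMap {T T' T'' : TopRep.{u} ℤ Γ} (hT : T.IsDiscrete) (hT' : T'.IsDiscrete)
    (hT'' : T''.IsDiscrete) {f : T.V →+ T'.V} (hf : ∀ g t, f (T.act g t) = T'.act g (f t))
    {f' : T'.V →+ T''.V} (hf' : ∀ g t, f' (T'.act g t) = T''.act g (f' t))
    (hinj : Function.Injective f) (hsurj : Function.Surjective f') (hzero : ∀ t, f' (f t) = 0)
    (hex : ∀ t, f' t = 0 → ∃ s, f s = t) :
    ∃ w : coindMap hT hT' f ≫ coindMap hT' hT'' f' = 0, (ShortComplex.mk _ _ w).ShortExact := by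
  have := hT.discreteTopology
  have := hT'.discreteTopology
  have := hT''.discreteTopology
  refine ⟨DiscRep.hom_ext fun c => TopRep.coind_ext fun x => ?_,
    (DiscRep.shortExact_iff _).2 ⟨fun a b h => TopRep.coind_ext fun x => hinj ?_, fun c => ?_,
      fun c hc => ?_⟩⟩
  · rw [fn_comp]
    refine (coindEval_coindMap hT' hT'' hf' x _).trans ?_
    rw [coindEval_coindMap hT hT' hf x c, hzero]
    rfl
  · have := congrArg (T'.coindEval x) h
    dsimp only at this
    rwa [coindEval_coindMap hT hT' hf, coindEval_coindMap hT hT' hf] at this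
  · choose s hs using hsurj
    refine ⟨T'.coindMk (fun x => s (T''.coindEval x c))
      (continuous_of_discreteTopology.comp (T''.continuous_coindEval c)),
      TopRep.coind_ext fun x => ?_⟩
    refine (coindEval_coindMap hT' hT'' hf' x _).trans ?_
    exact hs _
  · have h (x : Γ) : ∃ s, f s = T'.coindEval x c := hex _ <| by
      rw [← coindEval_coindMap hT' hT'' hf']
      exact congrArg (T''.coindEval x) hc
    let s : T'.V → T.V := Function.invFun f
    refine ⟨T.coindMk (fun x => s (T'.coindEval x c))
      ((continuous_of_discreteTopology (f := s)).comp (T'.continuous_coindEval c)),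
      TopRep.coind_ext fun x => ?_⟩
    refine (coindEval_coindMap hT hT' hf x _).trans ?_
    exact Function.invFun_eq (h x)

/-- Coinduced modules are acyclic. -/
lemma subsingleton_ext_unit_coind [HasExt.{w} (DiscMod Γ)] {ℓ : ℕ} (hℓ : ℓ.Prime)
    {T : TopRep.{u} ℤ Γ} (hT : T.IsDiscrete) (hp : IsPrimary ℓ T.V) (n : ℕ) :
    Subsingleton (Ext (unit Γ) (coind hT) (n + 1)) := by
  -- Coinducing `0 → T → J → Q → 0` gives an injective resolution of length one, as `J` and `Q` are
  -- divisible. Only `Ext^1` remains: morphisms from `ℤ` to a coinduced module are elements of the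
  -- coefficients, and `J → Q` is surjective.
  obtain ⟨J, Q, i, p, w, hS, hJ, hJd, hJp, hQd, hQp⟩ :=
    exists_shortExact_injective hℓ (T.toDiscRep hT) hp
  obtain ⟨hi, hps, hex⟩ := (DiscRep.shortExact_iff _).1 hS
  obtain ⟨w', hS'⟩ := shortExact_coindMap hT J.isDiscrete_toTopRep Q.isDiscrete_toTopRep
    (f := fn i) (f' := fn p) (fn_act i) (fn_act p) hi hps
    (fun t => congrArg (fun h => fn h t) w) hex
  have hJ' := injective_coind J.isDiscrete_toTopRep hJd
  have hQ' := injective_coind Q.isDiscrete_toTopRep hQd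
  cases n with
  | zero =>
    refine hS'.subsingleton_ext_one_of_exists_lift _ (Ext.subsingleton_of_injective _ _ _)
      fun f => ?_
    obtain ⟨j, hj⟩ := hps (Q.toTopRep.coindEval 1 (fn f (one Γ)))
    let g := coindLift (unit Γ) J.isDiscrete_toTopRep (unitMap (A := J.toTopRep.V) j)
    refine ⟨g, coind_hom_ext (hT := Q.isDiscrete_toTopRep) fun n => unitMap_ext
      (f := (Q.toTopRep.coindEval 1).comp
        (fn (g ≫ coindMap J.isDiscrete_toTopRep Q.isDiscrete_toTopRep (fn p))))
      (g := (Q.toTopRep.coindEval 1).comp (fn f)) ?_ n⟩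
    refine Eq.trans ?_ hj
    refine (coindEval_coindMap J.isDiscrete_toTopRep Q.isDiscrete_toTopRep (fn_act p) 1 _).trans ?_
    refine congrArg (fn p) ((coindEval_coindLift (unit Γ) J.isDiscrete_toTopRep
      (unitMap (A := J.toTopRep.V) j) 1 (one Γ)).trans ?_)
    rw [TopRep.act_one, inv_one, DiscRep.act_one]
    exact unitMap_one _
  | succ n =>
    exact hS'.subsingleton_ext_X₁ (n := n + 1) _ (Ext.subsingleton_of_injective _ _ _)
      (Ext.subsingleton_of_injective _ _ _)

end DiscMod

end CoinducedAcyclicity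

/-! ### Internal `Hom` from a finite module -/

section InternalHom

universe w

namespace DiscMod

open DiscRep (fn act fn_act fn_comp)

variable {Γ : Type u} [Group Γ] [TopologicalSpace Γ] [IsTopologicalGroup Γ]

/-- The action of the group on the additive maps between two discrete modules by conjugation. -/
def ihomRepresentation (X N : DiscMod Γ) : Representation ℤ Γ (X.V →+ N.V) where
  toFun g := AddMonoidHom.toIntLinearMap
    { toFun := fun f => (N.act g).comp (f.comp (X.act g⁻¹))
      map_zero' := by ext; simp
      map_add' := fun _ _ => by ext; simp }
  map_one' := by
    ext f x
    change N.act 1 (f (X.act 1⁻¹ x)) = f x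
    simp
  map_mul' g h := by
    ext f x
    change N.act (g * h) (f (X.act (g * h)⁻¹ x)) =
      N.act g (N.act h (f (X.act h⁻¹ (X.act g⁻¹ x))))
    rw [mul_inv_rev, DiscRep.act_mul, DiscRep.act_mul]

/-- The discrete module of additive maps from a finite discrete module. -/
def ihom (X N : DiscMod Γ) [Finite X.V] : DiscMod Γ :=
  ⟨Rep.of (ihomRepresentation X N), fun f => by
    have : {g : Γ | ihomRepresentation X N g f = f} =
        ⋂ x : X.V, {g : Γ | N.act g (f (X.act g⁻¹ x)) = f x} := by
      ext g
      simp only [Set.mem_iInter]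
      exact ⟨fun h x => congr($h x), fun h => AddMonoidHom.ext h⟩
    change IsOpen {g : Γ | ihomRepresentation X N g f = f}
    rw [this]
    refine isOpen_iInter_of_finite fun x => ?_
    let : TopologicalSpace N.V := ⊥
    have : DiscreteTopology N.V := ⟨rfl⟩
    have h₁ : Continuous fun p : Γ × N.V => N.act p.1 p.2 := by
      rw [continuous_prod_of_discrete_right]
      exact fun t => (N.isLocallyConstant_act t).continuous
    have h₂ : Continuous fun g => N.act g (f (X.act g⁻¹ x)) :=
      h₁.comp (continuous_id.prodMk
        (((X.isLocallyConstant_act x).comp f).continuous.comp continuous_inv))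
    exact (isOpen_discrete {f x}).preimage h₂⟩

variable {X N N' N'' : DiscMod Γ} [Finite X.V]

/-- The evaluation of an element of the internal `Hom`. -/
def ihomEval (x : X.V) : (ihom X N).V →+ N.V :=
  AddMonoidHom.eval (N := N.V) x

/-- The element of the internal `Hom` attached to an additive map. -/
def ihomMk (f : X.V →+ N.V) : (ihom X N).V := f

/-- The additive map attached to an element of the internal `Hom`. -/
def ihomHom (f : (ihom X N).V) : X.V →+ N.V := f

@[simp]
lemma ihomEval_ihomMk (f : X.V →+ N.V) (x : X.V) : ihomEval x (ihomMk f) = f x := rfl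

@[simp]
lemma ihomHom_apply (f : (ihom X N).V) (x : X.V) : ihomHom f x = ihomEval x f := rfl

lemma ihom_ext {f f' : (ihom X N).V} (h : ∀ x, ihomEval x f = ihomEval x f') : f = f' :=
  AddMonoidHom.ext h

@[simp]
lemma ihomEval_act (g : Γ) (f : (ihom X N).V) (x : X.V) :
    ihomEval x ((ihom X N).act g f) = N.act g (ihomEval (X.act g⁻¹ x) f) := rfl

lemma isPrimary_ihom {ℓ : ℕ} (hX : IsPrimary ℓ X.V) : IsPrimary ℓ (ihom X N).V := fun f => by
  obtain ⟨n, hn⟩ := hX.exists_pow_of_finite (Set.toFinite Set.univ)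
  refine ⟨n, ihom_ext fun x => ?_⟩
  rw [map_nsmul, map_zero, ← ihomHom_apply, ← map_nsmul, hn x (Set.mem_univ x), map_zero]

/-- The functoriality of the internal `Hom`. -/
def ihomMap (X : DiscMod Γ) [Finite X.V] (p : N ⟶ N') : ihom X N ⟶ ihom X N' :=
  mkHom
    { toFun := fun f => ihomMk ((fn p).comp (ihomHom f))
      map_zero' := ihom_ext fun x => by simp
      map_add' := fun _ _ => ihom_ext fun x => by simp }
    fun g f => ihom_ext fun x => by simp [fn_act]

@[simp]
lemma ihomEval_ihomMap (p : N ⟶ N') (f : (ihom X N).V) (x : X.V) :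
    ihomEval x (fn (ihomMap X p) f) = fn p (ihomEval x f) := rfl

/-- The morphism from `ℤ` to the internal `Hom` attached to a morphism. -/
def unitToIhom (f : X ⟶ N) : unit Γ ⟶ ihom X N :=
  unitHom (ihomMk (fn f)) fun g => ihom_ext fun x => by simp [← fn_act]

/-- The morphism attached to a morphism from `ℤ` to the internal `Hom`. -/
def ofUnitToIhom (f : unit Γ ⟶ ihom X N) : X ⟶ N :=
  mkHom (ihomHom (fn f (one Γ))) fun g x => by
    have h := congrArg (ihomEval (X.act g x)) (act_fn_one f g)
    rw [ihomEval_act, DiscRep.act_inv_act] at h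
    exact h.symm

/-- The sequence splits: if `r` retracts `i`, then `id - i ∘ r` kills the image of `i` and descends
to a section of `p`. -/
lemma exists_addMonoidHom_lift {A B C X : Type u} [AddCommGroup A] [AddCommGroup B]
    [AddCommGroup C] [AddCommGroup X] (hA : IsDivisible A) {i : A →+ B} {p : B →+ C}
    (hi : Function.Injective i) (hp : Function.Surjective p) (hpi : ∀ a, p (i a) = 0)
    (hex : ∀ b, p b = 0 → ∃ a, i a = b) (f : X →+ C) : ∃ g : X →+ B, ∀ x, p (g x) = f x := by
  obtain ⟨r, hr⟩ := hA.exists_extension i hi (AddMonoidHom.id A)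
  choose s hs using hp
  let e : B →+ B := AddMonoidHom.id B - i.comp r
  have he (b : B) : p (e b) = p b := by simp [e, hpi]
  let t : C →+ B := p.liftOfRightInverse s hs ⟨e, fun b hb => by
    obtain ⟨a, rfl⟩ := hex b hb
    simp [e, hr, AddMonoidHom.mem_ker]⟩
  have ht (c : C) : p (t c) = c := by
    rw [← hs c, AddMonoidHom.liftOfRightInverse_comp_apply, he]
  exact ⟨t.comp f, fun x => ht _⟩

lemma shortExact_ihomMap (X : DiscMod Γ) [Finite X.V] {i : N ⟶ N'} {p : N' ⟶ N''} {w : i ≫ p = 0}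
    (hS : (ShortComplex.mk i p w).ShortExact) (hN : IsDivisible N.V) :
    ∃ w' : ihomMap X i ≫ ihomMap X p = 0, (ShortComplex.mk _ _ w').ShortExact := by
  obtain ⟨hi, hp, hex⟩ := (DiscRep.shortExact_iff _).1 hS
  have hpi (a : N.V) : fn p (fn i a) = 0 := congrArg (fun h => fn h a) w
  refine ⟨DiscRep.hom_ext fun f => ihom_ext fun x => by simp [hpi], (DiscRep.shortExact_iff _).2
    ⟨fun f f' h => ihom_ext fun x => hi ?_, fun f => ?_, fun f hf => ?_⟩⟩
  · exact congrArg (ihomEval x) h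
  · obtain ⟨g, hg⟩ := exists_addMonoidHom_lift hN hi hp hpi hex (ihomHom f)
    exact ⟨ihomMk g, ihom_ext hg⟩
  · choose s hs using fun x => hex (ihomEval x f) (congrArg (ihomEval x) hf)
    refine ⟨ihomMk (AddMonoidHom.mk' s fun a b => hi ?_), ihom_ext hs⟩
    dsimp only at hs ⊢
    rw [map_add, hs, hs, hs, ← ihomHom_apply, map_add, ihomHom_apply, ihomHom_apply]

variable [CompactSpace Γ]

/-- The internal `Hom` into an injective module is acyclic. -/
lemma subsingleton_ext_unit_ihom [HasExt.{w} (DiscMod Γ)] {ℓ : ℕ} (hℓ : ℓ.Prime)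
    (hX : IsPrimary ℓ X.V) (J : DiscMod Γ) [Injective J] (n : ℕ) :
    Subsingleton (Ext (unit Γ) (ihom X J) (n + 1)) := by
  have hJ := J.isDiscrete_toTopRep
  have hH := (ihom X J).isDiscrete_toTopRep
  have := hJ.discreteTopology
  have := hH.discreteTopology
  -- Being injective, `J` is a retract of `coind hJ`. Applying the retraction `r` to `y ↦ F y x` for
  -- each `x` makes `ihom X J` a retract of its own coinduced module: `c'` sends `f` to the constant
  -- function `f`, and `c` does the same for elements of `J`.
  let c : J ⟶ coind hJ := coindLift J hJ (AddMonoidHom.id J.V)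
  have : Mono c := (DiscRep.mono_iff _).2 (coindLift_injective hJ Function.injective_id)
  let r : coind hJ ⟶ J := Injective.factorThru (𝟙 J) c
  have hr (a : J.V) : fn r (fn c a) = a := congr(fn $(Injective.comp_factorThru (𝟙 J) c) a)
  let ev (F : (coind hH).V) (x : X.V) : (coind hJ).V :=
    J.toTopRep.coindMk (fun y => ihomEval x ((ihom X J).toTopRep.coindEval y F))
      (continuous_of_discreteTopology.comp ((ihom X J).toTopRep.continuous_coindEval F))
  let R : coind hH ⟶ ihom X J := mkHom
    { toFun := fun F => ihomMk
        { toFun := fun x => fn r (ev F x)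
          map_zero' := (congrArg (fn r) (TopRep.coind_ext fun y =>
            (ihomHom ((ihom X J).toTopRep.coindEval y F)).map_zero)).trans (map_zero _)
          map_add' := fun a b => (congrArg (fn r) (TopRep.coind_ext fun y =>
            (ihomHom ((ihom X J).toTopRep.coindEval y F)).map_add a b)).trans
              (map_add _ (ev F a) (ev F b)) }
      map_zero' := ihom_ext fun x => map_zero (fn r)
      map_add' := fun F F' => ihom_ext fun x => map_add (fn r) (ev F x) (ev F' x) }
    fun g F => ihom_ext fun x => fn_act r g (ev F (X.act g⁻¹ x))
  let c' : ihom X J ⟶ coind hH := coindLift (ihom X J) hH (AddMonoidHom.id _)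
  have hR : c' ≫ R = 𝟙 _ := DiscRep.hom_ext fun f => ihom_ext fun x => by
    refine Eq.trans (congrArg (fn r) (TopRep.coind_ext fun y => ?_)) (hr (ihomEval x f))
    have h₁ : (ihom X J).toTopRep.coindEval y (fn c' f) = f :=
      (coindEval_coindLift (ihom X J) hH _ y f).trans ((ihom X J).act_act_inv y f)
    have h₂ : J.toTopRep.coindEval y (fn c (ihomEval x f)) = ihomEval x f :=
      (coindEval_coindLift J hJ _ y _).trans (J.act_act_inv y _)
    exact (congrArg (ihomEval x) h₁).trans h₂.symm
  have := subsingleton_ext_unit_coind hℓ hH (isPrimary_ihom hX) n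
  refine subsingleton_of_forall_eq 0 fun e => ?_
  rw [← e.comp_mk₀_id, ← hR, ← Ext.mk₀_comp_mk₀, ← Ext.comp_assoc_of_third_deg_zero,
    Subsingleton.elim (e.comp (Ext.mk₀ c') (add_zero _)) 0, Ext.zero_comp]

end DiscMod

end InternalHom

/-! ### Finite submodules, and `Ext` of finite versus all discrete modules -/

section FiniteSubmodules

universe w

namespace DiscMod

open DiscRep (fn act fn_act fn_comp)

variable {Γ : Type u} [Group Γ] [TopologicalSpace Γ] [IsTopologicalGroup Γ]

/-- The restriction of the action to a stable subgroup. -/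
def subRepresentation (M : DiscMod Γ) (W : AddSubgroup M.V) (hW : ∀ g, ∀ w ∈ W, M.act g w ∈ W) :
    Representation ℤ Γ W where
  toFun g := AddMonoidHom.toIntLinearMap
    (((M.act g).comp W.subtype).codRestrict W fun w => hW g w w.2)
  map_one' := by
    ext w
    exact M.act_one w
  map_mul' g h := by
    ext w
    exact M.act_mul g h w

/-- The discrete module attached to a stable subgroup. -/
def sub (M : DiscMod Γ) (W : AddSubgroup M.V) (hW : ∀ g, ∀ w ∈ W, M.act g w ∈ W) : DiscMod Γ :=
  ⟨Rep.of (subRepresentation M W hW), fun w => by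
    have : {g : Γ | subRepresentation M W hW g w = w} = {g | M.act g w = w} := by
      ext g
      exact Subtype.ext_iff
    change IsOpen {g : Γ | subRepresentation M W hW g w = w}
    rw [this]
    exact M.isOpen_stabilizer w⟩

/-- The inclusion of a stable subgroup. -/
def subι (M : DiscMod Γ) (W : AddSubgroup M.V) (hW : ∀ g, ∀ w ∈ W, M.act g w ∈ W) :
    sub M W hW ⟶ M :=
  mkHom W.subtype fun _ _ => rfl

lemma subι_injective (M : DiscMod Γ) (W : AddSubgroup M.V) (hW : ∀ g, ∀ w ∈ W, M.act g w ∈ W) :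
    Function.Injective (fn (subι M W hW)) := Subtype.val_injective

variable [CompactSpace Γ]

/-- Every finite set of elements of an `ℓ`-primary discrete module lies in a finite submodule. -/
lemma exists_finite_submodule {ℓ : ℕ} (hℓ : ℓ.Prime) (M : DiscMod Γ) (hM : IsPrimary ℓ M.V)
    {S : Set M.V} (hS : S.Finite) :
    ∃ (W : DiscMod Γ) (i : W ⟶ M), Function.Injective (fn i) ∧ Finite W.V ∧ IsPrimary ℓ W.V ∧
      S ⊆ Set.range (fn i) := by
  -- Orbits are finite by compactness of `Γ`, and a finitely generated torsion abelian group is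
  -- finite.
  let O : Set M.V := ⋃ s ∈ S, Set.range fun g => M.act g s
  have hO : O.Finite := hS.biUnion fun s _ => (M.isLocallyConstant_act s).range_finite
  let W : AddSubgroup M.V := AddSubgroup.closure O
  have hOW (g : Γ) : W ≤ W.comap (M.act g) := by
    refine (AddSubgroup.closure_le _).2 fun m hm => ?_
    simp only [O, Set.mem_iUnion] at hm
    obtain ⟨s, hs, h, rfl⟩ := hm
    refine AddSubgroup.subset_closure ?_
    simp only [O, Set.mem_iUnion]
    exact ⟨s, hs, g * h, M.act_mul g h s⟩
  have hprim : IsPrimary ℓ W := hM.of_injective W.subtype Subtype.val_injective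
  have : AddGroup.FG W :=
    (AddGroup.fg_iff_addSubgroup_fg W).2 ((AddSubgroup.fg_iff W).2 ⟨O, rfl, hO⟩)
  have : Finite W := AddCommGroup.finite_of_fg_isAddTorsion W fun w => by
    obtain ⟨n, hn⟩ := hprim w
    exact isOfFinAddOrder_iff_nsmul_eq_zero.2 ⟨ℓ ^ n, pow_pos hℓ.pos n, hn⟩
  refine ⟨sub M W fun g w hw => hOW g hw, subι M W _, subι_injective M W _, this, hprim,
    fun s hs => ⟨⟨s, AddSubgroup.subset_closure ?_⟩, rfl⟩⟩
  simp only [O, Set.mem_iUnion]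
  exact ⟨s, hs, 1, M.act_one s⟩

lemma isPrimary_pullback {ℓ : ℕ} {X Y Z : DiscMod Γ} (f : X ⟶ Z) (g : Y ⟶ Z)
    (hX : IsPrimary ℓ X.V) (hY : IsPrimary ℓ Y.V) : IsPrimary ℓ (pullback f g : DiscMod Γ).V :=
  fun a => by
  obtain ⟨m, hm⟩ := hX (fn (pullback.fst f g) a)
  obtain ⟨n, hn⟩ := hY (fn (pullback.snd f g) a)
  refine ⟨m + n, DiscRep.pullback_ext f g _ _ ?_ ?_⟩
  · rw [map_nsmul, map_zero, pow_smul_eq_zero_of_le hm (by lia)]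
  · rw [map_nsmul, map_zero, pow_smul_eq_zero_of_le hn (by lia)]

/-- Extension classes of positive degree from a finite module to an `ℓ`-primary one are killed by
an epimorphism from a finite module. -/
lemma exists_finite_epi_mk₀_comp_eq_zero [HasExt.{w} (DiscMod Γ)] {ℓ : ℕ} (hℓ : ℓ.Prime)
    {X Q : DiscMod Γ} (hXf : Finite X.V) (hX : IsPrimary ℓ X.V) (hQ : IsPrimary ℓ Q.V) {n : ℕ}
    (e : Ext X Q (n + 1)) :
    ∃ (X' : DiscMod Γ) (p : X' ⟶ X), Finite X'.V ∧ IsPrimary ℓ X'.V ∧ Epi p ∧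
      (Ext.mk₀ p).comp e (zero_add _) = 0 := by
  induction n generalizing Q with
  | zero =>
    obtain ⟨J, Q', i, p, w, hS, hJ, -, hJp, -, -⟩ := exists_shortExact_injective hℓ Q hQ
    -- The class is the boundary of some `f : X ⟶ Q'`. It dies on the fibre product of `X` and `J`
    -- over `Q'`, and a finite submodule containing one lift of each element of `X` still surjects
    -- onto `X`.
    obtain ⟨y, rfl⟩ := Ext.covariant_sequence_exact₁ X hS e
      ((Ext.subsingleton_of_injective _ _ _).elim _ _) rfl
    obtain ⟨f, rfl⟩ := (Ext.mk₀_bijective _ _).2 y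
    have := hS.epi_g
    have hs : Function.Surjective (fn (pullback.fst f p)) := (DiscRep.epi_iff _).1 inferInstance
    choose s hs using hs
    obtain ⟨W, j, -, hWf, hW, hsW⟩ := exists_finite_submodule hℓ _
      (isPrimary_pullback f p hX hJp) (Set.finite_range s)
    refine ⟨W, j ≫ pullback.fst f p, hWf, hW, (DiscRep.epi_iff _).2 fun x => ?_, ?_⟩
    · obtain ⟨w, hw⟩ := hsW ⟨x, rfl⟩
      exact ⟨w, by rw [fn_comp, hw, hs]⟩
    · rw [Ext.mk₀_comp_mk₀_assoc, Category.assoc, pullback.condition, ← Category.assoc,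
        ← Ext.mk₀_comp_mk₀_assoc, hS.comp_extClass, Ext.comp_zero]
  | succ n ih =>
    obtain ⟨J, Q', i, p, w, hS, hJ, -, -, -, hQ'⟩ := exists_shortExact_injective hℓ Q hQ
    obtain ⟨y, rfl⟩ := Ext.covariant_sequence_exact₁ X hS e
      ((Ext.subsingleton_of_injective _ _ _).elim _ _) rfl
    obtain ⟨X', q, hX'f, hX', hq, h⟩ := ih hQ' y
    refine ⟨X', q, hX'f, hX', hq, ?_⟩
    rw [← Ext.comp_assoc (h₁₂ := zero_add (n + 1)) (h₂₃ := rfl) (h := by lia), h, Ext.zero_comp]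

end DiscMod

namespace FinDiscMod

variable {Γ : Type u} [Group Γ] [TopologicalSpace Γ] {ℓ : ℕ}

lemma le_openStabilizers (Γ : Type u) [Group Γ] [TopologicalSpace Γ] (ℓ : ℕ) :
    finiteDiscretePrimary ℤ Γ ℓ ≤ openStabilizers ℤ Γ := fun _ h => h.discrete

/-- The inclusion of the finite discrete `ℓ`-primary modules into the discrete modules. -/
abbrev incl (Γ : Type u) [Group Γ] [TopologicalSpace Γ] (ℓ : ℕ) : FinDiscMod Γ ℓ ⥤ DiscMod Γ :=
  ObjectProperty.ιOfLE (le_openStabilizers Γ ℓ)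

/-- The finite discrete `ℓ`-primary module attached to a discrete module that is finite and
`ℓ`-primary. -/
def of (M : DiscMod Γ) (hf : Finite M.V) (hp : DiscMod.IsPrimary ℓ M.V) : FinDiscMod Γ ℓ :=
  ⟨M.obj, ⟨hf, hp, M.property⟩⟩

variable [IsTopologicalGroup Γ]

instance : (incl Γ ℓ).Additive := ⟨rfl⟩

lemma subsingleton_ext_iff [CompactSpace Γ] [HasExt.{w} (FinDiscMod Γ ℓ)] [HasExt.{v} (DiscMod Γ)]
    (hℓ : ℓ.Prime) (X Y : FinDiscMod Γ ℓ) (n : ℕ) :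
    Subsingleton (Ext X Y n) ↔ Subsingleton (Ext ((incl Γ ℓ).obj X) ((incl Γ ℓ).obj Y) n) := by
  have := (finiteDiscretePrimary ℤ Γ ℓ).preservesFiniteLimits_ιOfLE (openStabilizers ℤ Γ)
    (le_openStabilizers Γ ℓ)
  have := (finiteDiscretePrimary ℤ Γ ℓ).preservesFiniteColimits_ιOfLE (openStabilizers ℤ Γ)
    (le_openStabilizers Γ ℓ)
  refine (Equiv.ofBijective _
    ((incl Γ ℓ).mapExt_bijective_of_effaceable ?_ X Y n)).subsingleton_congr
  intro X Y n e
  obtain ⟨X', p, hf, hp, _, h⟩ := DiscMod.exists_finite_epi_mk₀_comp_eq_zero hℓ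
    (X := (incl Γ ℓ).obj X) (Q := (incl Γ ℓ).obj Y) X.property.finite X.property.primary
    Y.property.primary e
  let X'' : FinDiscMod Γ ℓ := of X' hf hp
  let q : X'' ⟶ X := ObjectProperty.homMk p.hom
  have hq : (incl Γ ℓ).map q = p := rfl
  refine ⟨X'', q, ?_, h⟩
  have : Epi ((incl Γ ℓ).map q) := by rwa [hq]
  exact (incl Γ ℓ).epi_of_epi_map this

end FinDiscMod

end FiniteSubmodules

/-! ### Continuous cohomology as `Ext` from `ℤ` -/

section ContinuousCohomology

universe w

lemma TopModuleCat.subsingleton_homology_iff {R : Type*} [Ring R] [TopologicalSpace R]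
    (S : ShortComplex (TopModuleCat R)) :
    Subsingleton S.homology ↔ ∀ x : S.X₂, S.g.hom x = 0 → ∃ y : S.X₁, S.f.hom y = x := by
  let f' : S.X₁ ⟶ ker S.g := (isLimitKer S.g).lift (KernelFork.ofι S.f S.zero)
  have hf' (y : S.X₁) : (kerι S.g).hom (f'.hom y) = S.f.hom y :=
    congr(Hom.hom $((isLimitKer S.g).fac (KernelFork.ofι S.f S.zero) WalkingParallelPair.zero) y)
  let D : S.LeftHomologyData := ⟨_, _, _, _, _, isLimitKer S.g, by simp, isColimitCoker _⟩
  have hD : Subsingleton S.homology ↔ Subsingleton (coker f') := by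
    have e : S.homology ≃ (coker f' : TopModuleCat R) :=
      ((forget (TopModuleCat R)).mapIso D.homologyIso).toEquiv
    exact e.subsingleton_congr
  rw [hD]
  change Subsingleton (ker S.g ⧸ f'.hom.range) ↔ _
  rw [Submodule.Quotient.subsingleton_iff, eq_top_iff]
  refine ⟨fun h x hx => ?_, ?_⟩
  · obtain ⟨y, hy⟩ := h (x := ⟨x, hx⟩) Submodule.mem_top
    exact ⟨y, (hf' y).symm.trans congr(($hy).1)⟩
  · rintro h ⟨x, hx⟩ -
    obtain ⟨y, hy⟩ := h x hx
    exact ⟨y, Subtype.ext ((hf' y).trans hy)⟩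

namespace TopRep

variable {k : Type v} [CommRing k] [TopologicalSpace k] {Γ : Type u} [Group Γ]
  [TopologicalSpace Γ] [IsTopologicalGroup Γ]

/-- The additive map underlying a morphism of topological representations. -/
def fn {T T' : TopRep.{u} k Γ} (f : T ⟶ T') : T.V →+ T'.V := f.hom.toLinearMap.toAddMonoidHom

lemma fn_act {T T' : TopRep.{u} k Γ} (f : T ⟶ T') (g : Γ) (t : T.V) :
    fn f (T.act g t) = T'.act g (fn f t) :=
  congr($(f.hom.isIntertwining' g) t)

lemma coindEval_d_succ (T : TopRep.{u} k Γ) (n : ℕ) (x : Γ) (f : (T.resolutionX (n + 1)).V) :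
    (T.resolutionX (n + 1)).coindEval x (fn (T.d (n + 1)) f) =
      f - fn (T.d n) ((T.resolutionX n).coindEval x f) := rfl

/-- Evaluation at `1` is a contracting homotopy, not equivariant, so the standard complex is exact.
-/
lemma eq_d_of_d_eq_zero (T : TopRep.{u} k Γ) (n : ℕ) {f : (T.resolutionX (n + 1)).V}
    (hf : fn (T.d (n + 1)) f = 0) : f = fn (T.d n) ((T.resolutionX n).coindEval 1 f) := by
  have h := coindEval_d_succ T n 1 f
  rw [hf, map_zero] at h
  exact sub_eq_zero.1 h.symm

lemma d_d_apply (T : TopRep.{u} k Γ) (n : ℕ) (f : (T.resolutionX n).V) :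
    fn (T.d (n + 1)) (fn (T.d n) f) = 0 :=
  congr(fn $(d_comp_d T n) f)

/-- The elementwise criterion for the vanishing of continuous cohomology in positive degrees. -/
lemma subsingleton_continuousCohomology_iff (T : TopRep.{u} k Γ) (n : ℕ) :
    Subsingleton (continuousCohomology (n + 1) T) ↔
      ∀ f : (T.resolutionX (n + 2)).V, (∀ g, (T.resolutionX (n + 2)).act g f = f) →
        fn (T.d (n + 2)) f = 0 → ∃ e : (T.resolutionX (n + 1)).V,
          (∀ g, (T.resolutionX (n + 1)).act g e = e) ∧ fn (T.d (n + 1)) e = f := by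
  -- Cochains of degree `m` are the invariants of `resolutionX (m + 1)`; `resolutionX 0` is `T`
  -- itself.
  have e := ((forget (TopModuleCat k)).mapIso
    ((homogeneousCochains T).homologyIsoSc' n (n + 1) (n + 2) (by simp) (by simp))).toEquiv
  refine e.subsingleton_congr.trans ((TopModuleCat.subsingleton_homology_iff _).trans ?_)
  refine ⟨fun h f hf hd => ?_, fun h x hx => ?_⟩
  · obtain ⟨y, hy⟩ := h ⟨f, hf⟩
      (Subtype.ext ((homogeneousCochains.d_apply T (n + 1) ⟨f, hf⟩).trans hd))
    exact ⟨y.1, y.2, (homogeneousCochains.d_apply T n y).symm.trans congr(($hy).1)⟩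
  · obtain ⟨e, he, hd⟩ := h x.1 x.2
      ((homogeneousCochains.d_apply T (n + 1) x).symm.trans congr(($hx).1))
    exact ⟨⟨e, he⟩, Subtype.ext ((homogeneousCochains.d_apply T n ⟨e, he⟩).trans hd)⟩

/-- The functoriality of the standard resolution. -/
def resolutionMap {T T' : TopRep.{u} k Γ} (f : T ⟶ T') :
    (n : ℕ) → (T.resolutionX n ⟶ T'.resolutionX n)
  | 0 => f
  | n + 1 => (coind₁Functor k Γ).map (resolutionMap f n)

variable {T T' : TopRep.{u} k Γ} (f : T ⟶ T')

lemma coindEval_resolutionMap (n : ℕ) (x : Γ) (t : (T.resolutionX (n + 1)).V) :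
    (T'.resolutionX n).coindEval x (fn (resolutionMap f (n + 1)) t) =
      fn (resolutionMap f n) ((T.resolutionX n).coindEval x t) := rfl

lemma resolutionMap_d (n : ℕ) (t : (T.resolutionX n).V) :
    fn (resolutionMap f (n + 1)) (fn (T.d n) t) = fn (T'.d n) (fn (resolutionMap f n) t) := by
  induction n with
  | zero => rfl
  | succ n ih =>
    refine coind_ext fun x => ?_
    rw [coindEval_resolutionMap, coindEval_d_succ, coindEval_d_succ, map_sub, ih,
      coindEval_resolutionMap]

lemma resolutionMap_injective {f : T ⟶ T'} (hf : Function.Injective (fn f)) (n : ℕ) :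
    Function.Injective (fn (resolutionMap f n)) := by
  induction n with
  | zero => exact hf
  | succ n ih =>
    refine fun a b h => coind_ext fun x => ih ?_
    rw [← coindEval_resolutionMap, h, coindEval_resolutionMap]

end TopRep

/-- The morphism of topological representations attached to a morphism of discrete
representations. -/
def DiscRep.toTopRepMap {k : Type v} [CommRing k] [TopologicalSpace k] [DiscreteTopology k]
    {Γ : Type u} [Group Γ] [TopologicalSpace Γ] [IsTopologicalGroup Γ] {W : DiscRep k Γ}
    {T : TopRep.{u} k Γ} (hT : T.IsDiscrete) (i : W ⟶ T.toDiscRep hT) : W.toTopRep ⟶ T :=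
  TopRep.ofHom (X := W.toTopRep.V) (ρ := W.toTopRep.ρ)
    { toLinearMap := i.hom.hom.toLinearMap
      cont := by
        have := W.isDiscrete_toTopRep.discreteTopology
        exact continuous_of_discreteTopology (α := W.toTopRep.V)
      isIntertwining' := fun g => ContinuousLinearMap.ext fun w => DiscRep.fn_act i g w }

namespace DiscMod

variable {Γ : Type u} [Group Γ] [TopologicalSpace Γ] [IsTopologicalGroup Γ] [CompactSpace Γ]

lemma isPrimary_resolutionX {ℓ : ℕ} {T : TopRep.{u} ℤ Γ} (hT : T.IsDiscrete)
    (hp : IsPrimary ℓ T.V) (n : ℕ) : IsPrimary ℓ (T.resolutionX n).V := by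
  induction n with
  | zero => exact hp
  | succ n ih => exact isPrimary_coind (hT.resolutionX n) ih

/-- The elementwise criterion for the vanishing of `Ext` from the trivial module `ℤ`. -/
lemma subsingleton_ext_unit_iff [HasExt.{w} (DiscMod Γ)] {ℓ : ℕ} (hℓ : ℓ.Prime)
    {T : TopRep.{u} ℤ Γ} (hT : T.IsDiscrete) (hp : IsPrimary ℓ T.V) (n : ℕ) :
    Subsingleton (Ext (unit Γ) (T.toDiscRep hT) (n + 1)) ↔
      ∀ f : (T.resolutionX (n + 2)).V, (∀ g, (T.resolutionX (n + 2)).act g f = f) →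
        TopRep.fn (T.d (n + 2)) f = 0 → ∃ e : (T.resolutionX (n + 1)).V,
          (∀ g, (T.resolutionX (n + 1)).act g e = e) ∧ TopRep.fn (T.d (n + 1)) e = f := by
  let I (m : ℕ) : DiscMod Γ := (T.resolutionX (m + 1)).toDiscRep (hT.resolutionX (m + 1))
  let d (m : ℕ) : I m ⟶ I (m + 1) :=
    TopRep.toDiscRepMap (hT.resolutionX (m + 1)) (hT.resolutionX (m + 2)) (T.d (m + 1))
  let i : T.toDiscRep hT ⟶ I 0 := TopRep.toDiscRepMap hT (hT.resolutionX 1) (T.d 0)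
  have hd (m : ℕ) : d m ≫ d (m + 1) = 0 := DiscRep.hom_ext (T.d_d_apply (m + 1))
  have hi : i ≫ d 0 = 0 := DiscRep.hom_ext (T.d_d_apply 0)
  have : Mono i := (DiscRep.mono_iff i).2 fun a b h => congrArg (T.coindEval 1) h
  have hex (m : ℕ) : (ShortComplex.mk _ _ (hd m)).Exact :=
    (DiscRep.exact_iff _).2 fun x hx => ⟨_, (T.eq_d_of_d_eq_zero (m + 1) hx).symm⟩
  have hiex : (ShortComplex.mk _ _ hi).Exact :=
    (DiscRep.exact_iff _).2 fun x hx => ⟨_, (T.eq_d_of_d_eq_zero 0 hx).symm⟩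
  rw [Ext.subsingleton_iff_of_acyclic_resolution (unit Γ) n I d hd hex
    (fun m j => subsingleton_ext_unit_coind hℓ (hT.resolutionX m)
      (isPrimary_resolutionX hT hp m) j) i hi hiex]
  refine ⟨fun h f hf hdf => ?_, fun h f hf => ?_⟩
  · obtain ⟨e, he⟩ := h (unitHom (M := I (n + 1)) f hf) (unit_hom_ext
      ((congrArg (DiscRep.fn (d (n + 1))) (fn_unitHom_one (M := I (n + 1)) f hf)).trans hdf))
    exact ⟨DiscRep.fn e (one Γ), act_fn_one e,
      congr(DiscRep.fn $he (one Γ)).trans (fn_unitHom_one (M := I (n + 1)) f hf)⟩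
  · obtain ⟨e, he, hde⟩ := h (DiscRep.fn f (one Γ)) (act_fn_one f) congr(DiscRep.fn $hf (one Γ))
    exact ⟨unitHom (M := I n) e he, unit_hom_ext
      ((congrArg (DiscRep.fn (d n)) (fn_unitHom_one (M := I n) e he)).trans hde)⟩

/-- Cochains of an `ℓ`-primary module come from finite submodules. -/
lemma exists_finite_resolutionMap {ℓ : ℕ} (hℓ : ℓ.Prime) {T : TopRep.{u} ℤ Γ} (hT : T.IsDiscrete)
    (hp : IsPrimary ℓ T.V) (n : ℕ) {S : Set (T.resolutionX n).V} (hS : S.Finite) :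
    ∃ (W : DiscMod Γ) (i : W.toTopRep ⟶ T), Function.Injective (TopRep.fn i) ∧ Finite W.V ∧
      IsPrimary ℓ W.V ∧ S ⊆ Set.range (TopRep.fn (TopRep.resolutionMap i n)) := by
  induction n with
  | zero =>
    obtain ⟨W, i, hi, hf, hp, hW⟩ := exists_finite_submodule hℓ (T.toDiscRep hT) hp hS
    exact ⟨W, DiscRep.toTopRepMap hT i, hi, hf, hp, hW⟩
  | succ n ih =>
    -- The induction runs over finite sets, since one cochain has to be replaced by all its values
    -- one level down.
    obtain ⟨W, i, hi, hf, hWp, hW⟩ := ih (S := ⋃ f ∈ S, Set.range fun x =>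
        (T.resolutionX n).coindEval x f)
      (hS.biUnion fun f _ => TopRep.finite_range_coindEval (hT.resolutionX n) f)
    refine ⟨W, i, hi, hf, hWp, fun f hfS => ?_⟩
    have hfW (x : Γ) : ∃ w, TopRep.fn (TopRep.resolutionMap i n) w =
        (T.resolutionX n).coindEval x f := hW (by
      simp only [Set.mem_iUnion]
      exact ⟨f, hfS, x, rfl⟩)
    let s := Function.invFun (TopRep.fn (TopRep.resolutionMap i n))
    have := (hT.resolutionX n).discreteTopology
    refine ⟨(W.toTopRep.resolutionX n).coindMk (fun x => s ((T.resolutionX n).coindEval x f))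
      ((continuous_of_discreteTopology (f := s)).comp
        ((T.resolutionX n).continuous_coindEval f)), TopRep.coind_ext fun x => ?_⟩
    exact Function.invFun_eq (hfW x)

/-- Continuous cohomology with `ℓ`-primary coefficients vanishes in positive degrees if and only
if the corresponding `Ext`-group does. -/
lemma subsingleton_continuousCohomology_iff_ext [HasExt.{w} (DiscMod Γ)] {ℓ : ℕ} (hℓ : ℓ.Prime)
    {T : TopRep.{u} ℤ Γ} (hT : T.IsDiscrete) (hp : IsPrimary ℓ T.V) (n : ℕ) :
    Subsingleton (continuousCohomology (n + 1) T) ↔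
      Subsingleton (Ext (unit Γ) (T.toDiscRep hT) (n + 1)) :=
  (T.subsingleton_continuousCohomology_iff n).trans (subsingleton_ext_unit_iff hℓ hT hp n).symm

/-- If `Ext` from `ℤ` vanishes on finite modules, then continuous cohomology vanishes on all
`ℓ`-primary modules. -/
lemma subsingleton_continuousCohomology_of_finite [HasExt.{w} (DiscMod Γ)] {ℓ : ℕ} (hℓ : ℓ.Prime)
    (n : ℕ) (h : ∀ W : DiscMod Γ, Finite W.V → IsPrimary ℓ W.V →
      Subsingleton (Ext (unit Γ) W (n + 1))) {T : TopRep.{u} ℤ Γ} (hT : T.IsDiscrete)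
    (hp : IsPrimary ℓ T.V) : Subsingleton (continuousCohomology (n + 1) T) := by
  refine (T.subsingleton_continuousCohomology_iff n).2 fun f hf hdf => ?_
  obtain ⟨W, i, hi, hWf, hWp, hW⟩ := exists_finite_resolutionMap hℓ hT hp (n + 2)
    (Set.finite_singleton f)
  obtain ⟨f, rfl⟩ := hW rfl
  -- Injectivity of `resolutionMap` makes the lift of `f` to `W` an invariant cocycle there, so it
  -- bounds in `W`, hence in `T`.
  obtain ⟨e, he, rfl⟩ := (subsingleton_ext_unit_iff hℓ W.isDiscrete_toTopRep hWp n).1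
    (h W hWf hWp) f
    (fun g => TopRep.resolutionMap_injective hi (n + 2) (by rw [TopRep.fn_act, hf]))
    (TopRep.resolutionMap_injective hi (n + 3) (by
      rw [TopRep.resolutionMap_d, hdf, map_zero]))
  exact ⟨TopRep.fn (TopRep.resolutionMap i (n + 1)) e, fun g => by rw [← TopRep.fn_act, he],
    (TopRep.resolutionMap_d i (n + 1) e).symm⟩

end DiscMod

end ContinuousCohomology

/-! ### Comparison of the two dimensions -/

section Comparison

universe w

namespace CategoryTheory.Abelian.Ext

variable {C : Type*} [Category* C] [Abelian C] [HasExt.{w} C] {X Y : C}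

lemma mk₀_nsmul_id_comp {n : ℕ} (x : Ext X Y n) (m : ℕ) :
    (mk₀ (m • 𝟙 X)).comp x (zero_add n) = m • x := by
  induction m with
  | zero => simp
  | succ m ih => rw [succ_nsmul, mk₀_add, add_comp, ih, mk₀_id_comp, succ_nsmul]

lemma comp_mk₀_nsmul_id {n : ℕ} (x : Ext X Y n) (m : ℕ) :
    x.comp (mk₀ (m • 𝟙 Y)) (add_zero n) = m • x := by
  induction m with
  | zero => simp
  | succ m ih => rw [succ_nsmul, mk₀_add, comp_add, ih, comp_mk₀_id, succ_nsmul]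

end CategoryTheory.Abelian.Ext

namespace DiscMod

open DiscRep (fn act fn_act fn_comp)

variable {Γ : Type u} [Group Γ] [TopologicalSpace Γ] [IsTopologicalGroup Γ]

lemma fn_nsmul_id (N : DiscMod Γ) (m : ℕ) (x : N.V) : fn (m • 𝟙 N) x = m • x := by
  induction m with
  | zero => simp
  | succ m ih =>
    rw [succ_nsmul, succ_nsmul, ← ih]
    rfl

/-- The trivial module `ℤ/ℓ`. -/
def zmod (Γ : Type u) [Group Γ] [TopologicalSpace Γ] (ℓ : ℕ) : DiscMod Γ :=
  trivial Γ (ULift.{u} (ZMod ℓ))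

/-- The generator of the trivial module `ℤ/ℓ`. -/
def zmodOne (Γ : Type u) [Group Γ] [TopologicalSpace Γ] (ℓ : ℕ) : (zmod Γ ℓ).V :=
  (⟨1⟩ : ULift.{u} (ZMod ℓ))

/-- The projection from `ℤ` to `ℤ/ℓ`. -/
def toZMod (Γ : Type u) [Group Γ] [TopologicalSpace Γ] [IsTopologicalGroup Γ] (ℓ : ℕ) :
    unit Γ ⟶ zmod Γ ℓ :=
  unitHom (zmodOne Γ ℓ) fun _ => rfl

lemma down_fn_toZMod (ℓ : ℕ) (n : ULift.{u} ℤ) :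
    ULift.down (α := ZMod ℓ) (fn (toZMod Γ ℓ) n) = (n.down : ZMod ℓ) := by
  change ULift.down (n.down • (⟨1⟩ : ULift.{u} (ZMod ℓ))) = _
  rw [ULift.smul_down, zsmul_one]

lemma shortExact_toZMod {ℓ : ℕ} (hℓ : ℓ.Prime) :
    ∃ w : (ℓ • 𝟙 (unit Γ)) ≫ toZMod Γ ℓ = 0, (ShortComplex.mk _ _ w).ShortExact := by
  have key (n : ULift.{u} ℤ) : fn (ℓ • 𝟙 (unit Γ)) n = (⟨ℓ * n.down⟩ : ULift.{u} ℤ) := by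
    refine (fn_nsmul_id _ _ _).trans (ULift.ext _ _ ?_)
    change ULift.down (ℓ • n) = _
    rw [ULift.smul_down, nsmul_eq_mul]
  refine ⟨DiscRep.hom_ext fun n => ULift.ext (α := ZMod ℓ) _ _ ?_, (DiscRep.shortExact_iff _).2
    ⟨fun (a : ULift ℤ) (b : ULift ℤ) h => ?_, fun (x : ULift (ZMod ℓ)) => ?_,
      fun (x : ULift ℤ) hx => ?_⟩⟩
  · refine (congr(ULift.down (α := ZMod ℓ) (fn (toZMod Γ ℓ) $(key n)))).trans
      ((down_fn_toZMod ℓ _).trans ?_)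
    change ((ℓ * _ : ℤ) : ZMod ℓ) = 0
    simp
  · dsimp only at h
    rw [key, key] at h
    have h' : (ℓ : ℤ) * a.down = ℓ * b.down := congrArg (ULift.down (α := ℤ)) h
    exact ULift.ext _ _ (mul_left_cancel₀ (by exact_mod_cast hℓ.ne_zero) h')
  · obtain ⟨n, hn⟩ := ZMod.intCast_surjective x.down
    exact ⟨(⟨n⟩ : ULift ℤ), ULift.ext (α := ZMod ℓ) _ _ ((down_fn_toZMod ℓ _).trans hn)⟩
  · have h : ((x.down : ℤ) : ZMod ℓ) = 0 :=
      (down_fn_toZMod (Γ := Γ) ℓ x).symm.trans (congrArg (ULift.down (α := ZMod ℓ)) hx)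
    obtain ⟨m, hm⟩ := (ZMod.intCast_zmod_eq_zero_iff_dvd _ _).1 h
    exact ⟨(⟨m⟩ : ULift ℤ), (key ⟨m⟩).trans (ULift.ext _ _ hm.symm)⟩

lemma finite_zmod {ℓ : ℕ} (hℓ : ℓ.Prime) : Finite (zmod Γ ℓ).V :=
  have := Fact.mk hℓ
  inferInstanceAs (Finite (ULift.{u} (ZMod ℓ)))

lemma isPrimary_zmod (ℓ : ℕ) : IsPrimary ℓ (zmod Γ ℓ).V := fun (x : ULift (ZMod ℓ)) =>
  ⟨1, show ℓ ^ 1 • x = 0 from ULift.ext _ _ (by simp)⟩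

/-- The vanishing of `Ext` from `ℤ/ℓ` implies the vanishing of `Ext` from `ℤ` one degree below. -/
lemma subsingleton_ext_unit_of_zmod [HasExt.{w} (DiscMod Γ)] {ℓ : ℕ} (hℓ : ℓ.Prime)
    {N : DiscMod Γ} (hf : Finite N.V) (hp : IsPrimary ℓ N.V) (n : ℕ)
    (h : Subsingleton (Ext (zmod Γ ℓ) N (n + 1))) : Subsingleton (Ext (unit Γ) N n) := by
  obtain ⟨w, hS⟩ := shortExact_toZMod (Γ := Γ) hℓ
  -- The obstruction to dividing by `ℓ` lies in `Ext^{n+1}(ℤ/ℓ, N)`. Since a power of `ℓ` kills `N`,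
  -- divisibility forces zero.
  have hdiv (x : Ext (unit Γ) N n) : ∃ y, ℓ • y = x := by
    obtain ⟨y, hy⟩ := Ext.contravariant_sequence_exact₁ hS N x (add_comm 1 n)
      (h.elim _ _)
    exact ⟨y, (Ext.mk₀_nsmul_id_comp y ℓ).symm.trans hy⟩
  have hdiv' (k : ℕ) (x : Ext (unit Γ) N n) : ∃ y, ℓ ^ k • y = x := by
    induction k with
    | zero => exact ⟨x, by simp⟩
    | succ k ih =>
      obtain ⟨y, rfl⟩ := ih
      obtain ⟨z, rfl⟩ := hdiv y
      exact ⟨z, by rw [pow_succ, mul_smul]⟩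
  obtain ⟨k, hk⟩ := hp.exists_pow_of_finite (Set.toFinite Set.univ)
  have hN : (ℓ ^ k) • 𝟙 N = 0 := DiscRep.hom_ext fun m => by
    rw [fn_nsmul_id, hk m (Set.mem_univ m), DiscRep.fn_zero]
  refine subsingleton_of_forall_eq 0 fun x => ?_
  obtain ⟨y, rfl⟩ := hdiv' k x
  rw [← Ext.comp_mk₀_nsmul_id, hN, Ext.mk₀_zero, Ext.comp_zero]

lemma not_subsingleton_ext_zmod [HasExt.{w} (DiscMod Γ)] {ℓ : ℕ} (hℓ : ℓ.Prime) :
    ¬ Subsingleton (Ext (zmod Γ ℓ) (zmod Γ ℓ) 1) := fun h => by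
  have := subsingleton_ext_unit_of_zmod hℓ (finite_zmod hℓ) (isPrimary_zmod ℓ) 0 h
  have h0 : toZMod Γ ℓ = 0 := (Ext.mk₀_bijective _ _).1 (Subsingleton.elim _ _)
  have h1 : zmodOne Γ ℓ = 0 :=
    (fn_unitHom_one _ _).symm.trans congr(fn $h0 (one Γ))
  have := Fact.mk hℓ
  exact one_ne_zero (α := ZMod ℓ) congr(ULift.down (α := ZMod ℓ) $h1)

variable [CompactSpace Γ]

/-- The vanishing of `Ext` from a finite module to a divisible module can be checked on the
internal `Hom`. -/
lemma subsingleton_ext_of_ihom [HasExt.{w} (DiscMod Γ)] {ℓ : ℕ} (hℓ : ℓ.Prime) {X Q : DiscMod Γ}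
    [Finite X.V] (hX : IsPrimary ℓ X.V) (hQd : IsDivisible Q.V) (hQ : IsPrimary ℓ Q.V) (n : ℕ)
    (h : Subsingleton (Ext (unit Γ) (ihom X Q) (n + 1))) : Subsingleton (Ext X Q (n + 1)) := by
  induction n generalizing Q with
  | zero =>
    obtain ⟨J, Q', i, p, w, hS, hJ, -⟩ := exists_shortExact_injective hℓ Q hQ
    obtain ⟨w', hS'⟩ := shortExact_ihomMap X hS hQd
    refine hS.subsingleton_ext_one_of_exists_lift X (Ext.subsingleton_of_injective _ _ _)
      fun f => ?_
    obtain ⟨g, hg⟩ := hS'.exists_lift_of_subsingleton_ext (unit Γ) h (unitToIhom f)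
    refine ⟨ofUnitToIhom g, DiscRep.hom_ext fun x => ?_⟩
    exact (congr(ihomEval x (fn $hg (one Γ)))).trans
      (congrArg (ihomEval x) (fn_unitHom_one (M := ihom X Q') _ _))
  | succ n ih =>
    obtain ⟨J, Q', i, p, w, hS, hJ, -, -, hQd', hQ'⟩ := exists_shortExact_injective hℓ Q hQ
    obtain ⟨w', hS'⟩ := shortExact_ihomMap X hS hQd
    -- Both sides shift alike: `J` is injective, `ihom X J` is acyclic, and `Q'` is again divisible
    -- and `ℓ`-primary.
    exact hS.subsingleton_ext_X₁ X (ih hQd' hQ' (hS'.subsingleton_ext_X₃ (unit Γ)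
      (subsingleton_ext_unit_ihom hℓ hX J n) h)) (Ext.subsingleton_of_injective _ _ _)

end DiscMod

/-- The set defining the dimension contains `⊤`, so its infimum in `ℕ∞` is attained; `Ext.chgUniv`
removes the dependence on the chosen `HasExt`. -/
lemma subsingleton_ext_of_homologicalDimension_lt {C : Type u} [Category.{v} C] [Abelian C]
    [HasExt.{w} C] {i : ℕ} (hi : homologicalDimension C < i) (X Y : C) :
    Subsingleton (Ext X Y i) := by
  have h := csInf_mem (s := {n : ℕ∞ | ∀ i : ℕ, n < (i : ℕ∞) → ∀ X Y : C,
    letI := HasExt.standard C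
    Subsingleton (Ext.{max u v} X Y i)}) ⟨⊤, fun i hi => absurd hi (by simp)⟩
  have := HasExt.standard C
  exact (Ext.chgUniv.{w, max u v}).subsingleton_congr.1 (h i hi X Y)

lemma homologicalDimension_le {C : Type u} [Category.{v} C] [Abelian C]
    [HasExt.{w} C] {n : ℕ∞} (h : ∀ i : ℕ, n < i → ∀ X Y : C, Subsingleton (Ext X Y i)) :
    homologicalDimension C ≤ n := by
  let := HasExt.standard C
  exact sInf_le fun i hi X Y => (Ext.chgUniv.{max u v, w}).subsingleton_congr.1 (h i hi X Y)

section

variable {Γ : Type u} [Group Γ] [TopologicalSpace Γ] [IsTopologicalGroup Γ] {ℓ : ℕ}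

lemma subsingleton_continuousCohomology_of_cohomologicalDimension_lt {i : ℕ}
    (hi : cohomologicalDimension Γ ℓ < i) {T : TopRep.{u} ℤ Γ} (hT : T.IsDiscrete)
    (hp : DiscMod.IsPrimary ℓ T.V) : Subsingleton (continuousCohomology i T) :=
  csInf_mem (s := {n : ℕ∞ | ∀ i : ℕ, n < (i : ℕ∞) → ∀ M : TopRep.{u} ℤ Γ,
    DiscreteTopology M.V → (∀ m : M.V, IsOpen {g : Γ | M.ρ g m = m}) →
    (∀ m : M.V, ∃ k : ℕ, ℓ ^ k • m = 0) → Subsingleton (continuousCohomology i M)})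
    ⟨⊤, fun i hi => absurd hi (by simp)⟩ i hi T hT.discreteTopology hT.isOpen_stabilizer hp

variable [CompactSpace Γ]

lemma homologicalDimension_le_cohomologicalDimension_add_one (hℓ : ℓ.Prime) :
    homologicalDimension (FinDiscMod Γ ℓ) ≤ cohomologicalDimension Γ ℓ + 1 := by
  have := HasExt.standard (FinDiscMod Γ ℓ)
  have := HasExt.standard (DiscMod Γ)
  refine homologicalDimension_le fun i hi X Y => ?_
  -- One degree is spent on passing from `Y` to `Q`; the other keeps the remaining degree positive,
  -- where `Ext` from `ℤ` is compared with cohomology.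
  obtain ⟨n, rfl⟩ : ∃ n, i = n + 2 := Nat.exists_eq_add_of_le' <| by
    have h : (1 : ℕ∞) < i := le_add_self.trans_lt hi
    exact_mod_cast h
  have hn : cohomologicalDimension Γ ℓ < (n + 1 : ℕ) := by
    refine lt_of_add_lt_add_right (a := 1) (hi.trans_eq ?_)
    push_cast
    rw [add_assoc, one_add_one_eq_two]
  rw [FinDiscMod.subsingleton_ext_iff hℓ]
  generalize hX : (FinDiscMod.incl Γ ℓ).obj X = X'
  generalize hY : (FinDiscMod.incl Γ ℓ).obj Y = Y'
  have hXf : Finite X'.V := hX ▸ X.property.finite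
  have hXp : DiscMod.IsPrimary ℓ X'.V := hX ▸ X.property.primary
  have hYp : DiscMod.IsPrimary ℓ Y'.V := hY ▸ Y.property.primary
  obtain ⟨J, Q, i, p, w, hS, hJ, -, -, hQd, hQ⟩ := DiscMod.exists_shortExact_injective hℓ Y' hYp
  refine hS.subsingleton_ext_X₁ X' (n := n + 1) (DiscMod.subsingleton_ext_of_ihom hℓ hXp hQd hQ n ?_)
    (Ext.subsingleton_of_injective _ _ _)
  have hT := (DiscMod.ihom X' Q).isDiscrete_toTopRep
  have hp := DiscMod.isPrimary_ihom (N := Q) hXp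
  exact (DiscMod.subsingleton_continuousCohomology_iff_ext hℓ hT hp n).1
    (subsingleton_continuousCohomology_of_cohomologicalDimension_lt hn hT hp)

lemma homologicalDimension_ne_zero (hℓ : ℓ.Prime) : homologicalDimension (FinDiscMod Γ ℓ) ≠ 0 :=
  fun h => by
  have := HasExt.standard (FinDiscMod Γ ℓ)
  have := HasExt.standard (DiscMod Γ)
  let F : FinDiscMod Γ ℓ :=
    FinDiscMod.of (DiscMod.zmod Γ ℓ) (DiscMod.finite_zmod hℓ) (DiscMod.isPrimary_zmod ℓ)
  exact DiscMod.not_subsingleton_ext_zmod hℓ ((FinDiscMod.subsingleton_ext_iff hℓ F F 1).1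
    (subsingleton_ext_of_homologicalDimension_lt (by simp [h]) F F))

lemma cohomologicalDimension_le (hℓ : ℓ.Prime) {m : ℕ∞}
    (hm : homologicalDimension (FinDiscMod Γ ℓ) ≤ m + 1) : cohomologicalDimension Γ ℓ ≤ m := by
  have := HasExt.standard (FinDiscMod Γ ℓ)
  have := HasExt.standard (DiscMod Γ)
  refine sInf_le fun i hi T h₁ h₂ hp => ?_
  obtain ⟨n, rfl⟩ : ∃ n, i = n + 1 := Nat.exists_eq_add_of_le' <| by
    have h : (0 : ℕ∞) < i := bot_le.trans_lt hi
    exact_mod_cast h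
  refine DiscMod.subsingleton_continuousCohomology_of_finite hℓ n (fun W hWf hWp => ?_) ⟨h₁, h₂⟩ hp
  refine DiscMod.subsingleton_ext_unit_of_zmod hℓ hWf hWp (n + 1) ?_
  have hn : homologicalDimension (FinDiscMod Γ ℓ) < (n + 1 + 1 : ℕ) := by
    refine hm.trans_lt ?_
    rw [Nat.cast_succ (n + 1)]
    exact (ENat.add_lt_add_iff_right (by simp)).2 hi
  exact (FinDiscMod.subsingleton_ext_iff hℓ
    (FinDiscMod.of (DiscMod.zmod Γ ℓ) (DiscMod.finite_zmod hℓ) (DiscMod.isPrimary_zmod ℓ))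
    (FinDiscMod.of W hWf hWp) _).1 (subsingleton_ext_of_homologicalDimension_lt hn _ _)

end

end Comparison

theorem mainTheorem8 (Γ : Type u) [Group Γ] [TopologicalSpace Γ] [IsTopologicalGroup Γ]
    [CompactSpace Γ] [TotallyDisconnectedSpace Γ] (ℓ : ℕ) (hℓ : ℓ.Prime) :
    homologicalDimension (FinDiscMod Γ ℓ) = cohomologicalDimension Γ ℓ + 1 := by
  refine le_antisymm (homologicalDimension_le_cohomologicalDimension_add_one hℓ) ?_
  -- Truncated subtraction is harmless because the dimension is nonzero.
  have h : homologicalDimension (FinDiscMod Γ ℓ) - 1 + 1 = homologicalDimension (FinDiscMod Γ ℓ) :=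
    tsub_add_cancel_of_le (Order.one_le_iff_pos.2 (pos_of_ne_zero (homologicalDimension_ne_zero hℓ)))
  rw [← h]
  gcongr
  exact cohomologicalDimension_le hℓ h.ge
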